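/- Let $M$ be a compact complex manifold of complex dimension $n$ with a smooth Hermitian metric $\omega=\langle\cdot,\cdot\rangle$, let $T_xM$ denote the $(1,0)$-type tangent space at $x\in M$, and let $R$ be the Chern curvature tensor of $(TM,\omega)$, i.e. $R(X,\overline Y,Z,\overline W)=\langle R_{X\overline Y}Z,W\rangle$ with $R_{X\overline{Y}}$ the curvature operator of the Chern connection. Assume that $\omega$ is Chern-Kähler-like, that is, $R(X,\overline Y,Z,\overline W)=R(Z,\overline Y,X,\overline W)$ for all $(1,0)$-type tangent vectors $X,Y,Z,W$ at the same point. Let $1\le k\le n$. For a $k$-dimensional complex subspace $\Sigma\subset T_xM$ with unitary basis $E_1,\dots,E_k$ put $$\mathrm{Ric}_k(x,\Sigma)(X,\overline X)=\sum_{i=1}^k R(X,\overline X,E_i,\overline{E_i})\quad(X\in\Sigma),$$ $$S_k(x,\Sigma)=\sum_{i,j=1}^k R(E_i,\overline{E_i},E_j,\overline{E_j}),\qquad R(\Sigma;X,\overline X)=\sum_{i=1}^k R(E_i,\overline{E_i},X,\overline X)\quad(X\in T_xM).$$ (1) Suppose $\mathrm{Ric}_k(\omega)>0$, i.e. $\mathrm{Ric}_k(x,\Sigma)(X,\overline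 X)>0$ for all $x\in M$, all $k$-dimensional $\Sigma\subset T_xM$ and all nonzero $X\in\Sigma$. Then $(TM,\omega)$ is uniformly RC $k$-positive: for every $x\in M$ there is a $k$-dimensional $\Sigma\subset T_xM$ such that $R(\Sigma;u,\overline u)>0$ for every nonzero $u\in T_xM$. More precisely, for every $x$ the function $S_k(x,\cdot)$ attains its minimum over the $k$-dimensional subspaces of $T_xM$; if $M\neq\emptyset$, the minimum $$D=\min\{\mathrm{Ric}_k(x,\Sigma)(X,\overline X): x\in M,\ \Sigma\subset T_xM,\ \dim\Sigma=k,\ X\in\Sigma,\ |X|=1\}$$ is attained and positive, and for every $x\in M$ and every $\Sigma$ minimizing $S_k(x,\cdot)$, $$R(\Sigma;X,\overline X)\ \ge\ \frac{kD}{k+1}\,|X|^2\qquad\text{for all }X\in T_xM.$$ (2) Suppose $\mathrm{Ric}_k(\omega)<0$ (the same condition with the inequality reversed). Then $(TM,\omega)$ is uniformly RC $k$-negative: for every $x\in M$ there is a $k$-dimensional $\Sigma\subset T_xM$ such that $R(\Sigma;u,\overline u)<0$ for every nonzero $u\in T_xM$. More precisely, for every $x$ the function $S_k(x,\cdot)$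 attains its maximum over the $k$-dimensional subspaces of $T_xM$; if $M\neq\emptyset$, the maximum $D$ of $\mathrm{Ric}_k(x,\Sigma)(X,\overline X)$ over the same set as in (1) is attained and negative, and for every $x\in M$ and every $\Sigma$ maximizing $S_k(x,\cdot)$, $R(\Sigma;X,\overline X)\le\frac{kD}{k+1}|X|^2$ for all $X\in T_xM$. -/

import Mathlib

open scoped Manifold ContDiff ComplexConjugate

/-- The `(1,0)`-part `∂f` of the differential of `f` at `z`, evaluated on `v`, i.e.
`∑ vⁱ ∂f/∂zⁱ`. It is complex linear in `v`. -/
noncomputable def wirtinger {E F : Type*} [NormedAddCommGroup E] [NormedSpace ℂ E]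
    [NormedAddCommGroup F] [NormedSpace ℂ F] (f : E → F) (z v : E) : F :=
  (1 / 2 : ℂ) • (fderiv ℝ f z v - Complex.I • fderiv ℝ f z (Complex.I • v))

/-- The `(0,1)`-part `∂̄f` of the differential of `f` at `z`, evaluated on the conjugate of `v`,
i.e. `∑ conj(vʲ) ∂f/∂z̄ʲ`. It is conjugate linear in `v`. -/
noncomputable def wirtingerBar {E F : Type*} [NormedAddCommGroup E] [NormedSpace ℂ E]
    [NormedAddCommGroup F] [NormedSpace ℂ F] (f : E → F) (z v : E) : F :=
  (1 / 2 : ℂ) • (fderiv ℝ f z v + Complex.I • fderiv ℝ f z (Complex.I • v))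

/-- A positive definite Hermitian form admits unitary bases of subspaces. -/
theorem exists_unitaryBasis_of_posDef {V : Type*} [AddCommGroup V] [Module ℂ V]
    [FiniteDimensional ℂ V] (B : V →ₗ[ℂ] V →ₗ⋆[ℂ] ℂ) (hsymm : ∀ v w, conj (B v w) = B w v)
    (hpos : ∀ v, v ≠ 0 → 0 < (B v v).re) (S : Submodule ℂ V) :
    ∃ e : Fin (Module.finrank ℂ S) → V, (∀ i j, B (e i) (e j) = if i = j then 1 else 0) ∧
      Submodule.span ℂ (Set.range e) = S := by
  let core : InnerProductSpace.Core ℂ V :=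
    { inner := fun v w => B w v
      conj_inner_symm := fun v w => hsymm v w
      re_inner_nonneg := fun v => by
        by_cases hv : v = 0
        · simp [hv]
        · exact (hpos v hv).le
      add_left := fun u v w => by simp
      smul_left := fun u v r => by simp
      definite := fun v hv => by
        by_contra hne
        have h0 := hpos v hne
        rw [hv] at h0
        simp at h0 }
  let : NormedAddCommGroup V := core.toNormedAddCommGroup
  let : InnerProductSpace ℂ V := InnerProductSpace.ofCore core.toCore
  let b := stdOrthonormalBasis ℂ S
  refine ⟨fun i => (b i : V), fun i j => ?_, ?_⟩
  · have h1 := orthonormal_iff_ite.mp b.orthonormal j i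
    have h2 : inner ℂ (b j) (b i) = B (b i : V) (b j : V) := rfl
    rw [← h2, h1]
    simp only [eq_comm]
  · have h1 : Submodule.span ℂ (Set.range b) = ⊤ := by
      have := b.toBasis.span_eq
      rwa [b.coe_toBasis] at this
    have h2 : Set.range (fun i => (b i : V)) = S.subtype '' Set.range b := by
      rw [← Set.range_comp]; rfl
    rw [h2, ← Submodule.map_span, h1, Submodule.map_top, Submodule.range_subtype]

/-- The tangent vector `∑ vⁱ ∂/∂zⁱ` at the point with coordinate `z` in the chart around `c`. -/
noncomputable def chartVector {E : Type*} [NormedAddCommGroup E] [NormedSpace ℂ E]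
    {M : Type*} [TopologicalSpace M] [ChartedSpace E M] [IsManifold 𝓘(ℂ, E) ω M] (c : M) (z : E) :
    E →L[ℂ] TangentSpace 𝓘(ℂ, E) ((extChartAt 𝓘(ℂ, E) c).symm z) :=
  tangentCoordChange 𝓘(ℂ, E) c ((extChartAt 𝓘(ℂ, E) c).symm z) ((extChartAt 𝓘(ℂ, E) c).symm z)

/-- A smooth Hermitian metric on a complex manifold `M` modelled on `E`. The complex vector space
`TangentSpace 𝓘(ℂ, E) x` is the holomorphic, i.e. `(1,0)`-type, tangent space at `x`. The metric is
complex linear in the first and conjugate linear in the second variable. Smoothness: in the chart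
around any `c`, the components of the metric in the coordinate frame are smooth
functions (in the real sense) of the coordinate. -/
structure HermitianMetric (E : Type*) [NormedAddCommGroup E] [NormedSpace ℂ E]
    (M : Type*) [TopologicalSpace M] [ChartedSpace E M] [IsManifold 𝓘(ℂ, E) ω M] where
  inner (x : M) : TangentSpace 𝓘(ℂ, E) x →ₗ[ℂ] TangentSpace 𝓘(ℂ, E) x →ₗ⋆[ℂ] ℂ
  conj_symm (x : M) (v w : TangentSpace 𝓘(ℂ, E) x) : conj (inner x v w) = inner x w v
  pos (x : M) (v : TangentSpace 𝓘(ℂ, E) x) (hv : v ≠ 0) : 0 < (inner x v v).re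
  smooth (c : M) (v w : E) :
    ContDiffOn ℝ ∞
      (fun z : E => inner ((extChartAt 𝓘(ℂ, E) c).symm z) (chartVector c z v) (chartVector c z w))
      (extChartAt 𝓘(ℂ, E) c).target

namespace HermitianMetric

variable {E : Type*} [NormedAddCommGroup E] [NormedSpace ℂ E]
  {M : Type*} [TopologicalSpace M] [ChartedSpace E M] [IsManifold 𝓘(ℂ, E) ω M]

/-- The metric in the coordinates `z` of the chart around `c`, applied to the vectors with
components `v` and `w`. -/
noncomputable def coord (h : HermitianMetric E M) (c : M) (z v w : E) : ℂ :=
  h.inner ((extChartAt 𝓘(ℂ, E) c).symm z) (chartVector c z v) (chartVector c z w)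

/-- The connection form of the Chern connection in the chart around `c`: `∇_X Z = Γ_X Z` for
vector fields `X`, `Z` of type `(1,0)` with constant components, where `Γ_X Z` is the unique vector
with `⟨Γ_X Z, W⟩ = ∂_X ⟨Z, W⟩` for all constant `W`. Equivalently
`Γᵖᵢₖ = ∑ g^{p q̄} ∂ᵢ g_{k q̄}`. -/
noncomputable def christoffel (h : HermitianMetric E M) (c : M) (z X Z : E) : E :=
  Classical.epsilon fun u : E =>
    ∀ W : E, h.coord c z u W = wirtinger (fun ζ => h.coord c ζ Z W) z X

/-- On the chart domain the defining equation of `christoffel` has exactly one solution. -/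
theorem existsUnique_christoffel [FiniteDimensional ℂ E] (h : HermitianMetric E M) (c : M) {z : E}
    (hz : z ∈ (extChartAt 𝓘(ℂ, E) c).target) (X Z : E) :
    ∃! u : E, ∀ W : E, h.coord c z u W = wirtinger (fun ζ => h.coord c ζ Z W) z X := by
  have hy : (extChartAt 𝓘(ℂ, E) c).symm z ∈ (extChartAt 𝓘(ℂ, E) c).source :=
    (extChartAt 𝓘(ℂ, E) c).map_target hz
  have hy' : (extChartAt 𝓘(ℂ, E) c).symm z ∈
      (extChartAt 𝓘(ℂ, E) ((extChartAt 𝓘(ℂ, E) c).symm z)).source := mem_extChartAt_source _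
  have hdiff : ∀ v w : E, DifferentiableAt ℝ (fun ζ => h.coord c ζ v w) z := fun v w =>
    ((h.smooth c v w).contDiffAt ((isOpen_extChartAt_target c).mem_nhds hz)).differentiableAt
      (by simp)
  have hA : ∀ v : E, chartVector c z v = 0 → v = 0 := fun v hv => by
    have h1 : tangentCoordChange 𝓘(ℂ, E) ((extChartAt 𝓘(ℂ, E) c).symm z) c
        ((extChartAt 𝓘(ℂ, E) c).symm z)
        (tangentCoordChange 𝓘(ℂ, E) c ((extChartAt 𝓘(ℂ, E) c).symm z)
        ((extChartAt 𝓘(ℂ, E) c).symm z) v) = v := by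
      rw [tangentCoordChange_comp ⟨⟨hy, hy'⟩, hy⟩, tangentCoordChange_self hy]
    have h2 : tangentCoordChange 𝓘(ℂ, E) c ((extChartAt 𝓘(ℂ, E) c).symm z)
        ((extChartAt 𝓘(ℂ, E) c).symm z) v = 0 := hv
    rw [← h1, h2, map_zero]
  let B : E →ₗ[ℂ] E →ₗ⋆[ℂ] ℂ :=
    LinearMap.mk₂'ₛₗ (RingHom.id ℂ) (starRingEnd ℂ) (fun v w => h.coord c z v w)
      (fun _ _ _ => by simp only [coord, map_add, LinearMap.add_apply])
      (fun _ _ _ => by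
        simp only [coord, map_smul, LinearMap.smul_apply, RingHom.id_apply])
      (fun _ _ _ => by simp only [coord, map_add])
      (fun _ _ _ => by simp only [coord, map_smul, LinearMap.map_smulₛₗ])
  have hB : ∀ v w, B v w = h.coord c z v w := fun v w => rfl
  have hpos : ∀ v, v ≠ 0 → 0 < (B v v).re := fun v hv => h.pos _ _ fun h0 => hv (hA v h0)
  have hadd : ∀ W₁ W₂ : E, wirtinger (fun ζ => h.coord c ζ Z (W₁ + W₂)) z X =
      wirtinger (fun ζ => h.coord c ζ Z W₁) z X + wirtinger (fun ζ => h.coord c ζ Z W₂) z X := by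
    intro W₁ W₂
    have h1 : (fun ζ => h.coord c ζ Z (W₁ + W₂)) =
        (fun ζ => h.coord c ζ Z W₁) + fun ζ => h.coord c ζ Z W₂ := by
      funext ζ
      simp only [coord, map_add, Pi.add_apply]
    unfold wirtinger
    rw [h1, fderiv_add (hdiff Z W₁) (hdiff Z W₂)]
    simp only [add_apply, smul_eq_mul]
    ring
  have hsmul : ∀ (a : ℂ) (W : E), wirtinger (fun ζ => h.coord c ζ Z (a • W)) z X =
      conj a * wirtinger (fun ζ => h.coord c ζ Z W) z X := by
    intro a W
    have h1 : (fun ζ => h.coord c ζ Z (a • W)) = fun ζ => conj a * h.coord c ζ Z W := by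
      funext ζ
      simp only [coord, map_smul, LinearMap.map_smulₛₗ, smul_eq_mul]
    unfold wirtinger
    rw [h1, fderiv_const_mul (hdiff Z W)]
    simp only [smul_apply, smul_eq_mul]
    ring
  let ℓ : E →ₗ⋆[ℂ] ℂ :=
    { toFun := fun W => wirtinger (fun ζ => h.coord c ζ Z W) z X
      map_add' := hadd
      map_smul' := hsmul }
  obtain ⟨e, he, hspan⟩ := exists_unitaryBasis_of_posDef B (fun v w => h.conj_symm _ _ _) hpos ⊤
  refine ⟨∑ i, ℓ (e i) • e i, ?_, ?_⟩
  · have h1 : B (∑ i, ℓ (e i) • e i) = ℓ := by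
      refine LinearMap.ext_on_range hspan fun j => ?_
      simp [he]
    intro W
    exact LinearMap.congr_fun h1 W
  · intro u hu
    have h1 : B u = ℓ := LinearMap.ext fun W => hu W
    have h2 : B (∑ i, ℓ (e i) • e i) = ℓ := by
      refine LinearMap.ext_on_range hspan fun j => ?_
      simp [he]
    by_contra hne
    have h3 := hpos _ (sub_ne_zero.mpr hne)
    have h4 : B (u - ∑ i, ℓ (e i) • e i) = 0 := by rw [map_sub B, h1, h2, sub_self]
    rw [h4] at h3
    simp at h3

/-- The curvature operator `R_{X Ȳ} Z` of the Chern connection of the holomorphic tangent bundle,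
in the chart around `x`: the curvature form is `∂̄Γ`, so that `R_{X Ȳ} Z = - ∂_Ȳ (Γ_X Z)`. -/
noncomputable def curvatureOp (h : HermitianMetric E M) (x : M)
    (X Y Z : TangentSpace 𝓘(ℂ, E) x) : TangentSpace 𝓘(ℂ, E) x :=
  (-wirtingerBar (F := E) (fun z : E => h.christoffel x z X Z) (extChartAt 𝓘(ℂ, E) x x) Y : E)

/-- The Chern curvature tensor `R(X, Ȳ, Z, W̄) = ⟨R_{X Ȳ} Z, W⟩`. -/
noncomputable def curvature (h : HermitianMetric E M) (x : M)
    (X Y Z W : TangentSpace 𝓘(ℂ, E) x) : ℂ :=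
  h.inner x (h.curvatureOp x X Y Z) W

/-- The metric is Chern-Kähler-like. -/
def IsChernKahlerLike (h : HermitianMetric E M) : Prop :=
  ∀ (x : M) (X Y Z W : TangentSpace 𝓘(ℂ, E) x), h.curvature x X Y Z W = h.curvature x Z Y X W

/-- `|X|²`. -/
noncomputable def normSq (h : HermitianMetric E M) (x : M) (X : TangentSpace 𝓘(ℂ, E) x) : ℝ :=
  (h.inner x X X).re

/-- `e` is a unitary basis of the subspace `S`. -/
def IsUnitaryBasis (h : HermitianMetric E M) (x : M)
    (S : Submodule ℂ (TangentSpace 𝓘(ℂ, E) x)) {k : ℕ} (e : Fin k → TangentSpace 𝓘(ℂ, E) x) :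
    Prop :=
  (∀ i j, h.inner x (e i) (e j) = if i = j then 1 else 0) ∧
    Submodule.span ℂ (Set.range e) = S

theorem exists_isUnitaryBasis [FiniteDimensional ℂ E] (h : HermitianMetric E M) (x : M)
    (S : Submodule ℂ (TangentSpace 𝓘(ℂ, E) x)) :
    ∃ e : Fin (Module.finrank ℂ S) → TangentSpace 𝓘(ℂ, E) x, h.IsUnitaryBasis x S e :=
  haveI : FiniteDimensional ℂ (TangentSpace 𝓘(ℂ, E) x) := inferInstanceAs (FiniteDimensional ℂ E)
  exists_unitaryBasis_of_posDef (h.inner x) (h.conj_symm x) (h.pos x) S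

/-- A unitary basis of `S`; the curvature quantities below do not depend on the choice. -/
noncomputable def unitaryBasis [FiniteDimensional ℂ E] (h : HermitianMetric E M) (x : M)
    (S : Submodule ℂ (TangentSpace 𝓘(ℂ, E) x)) :
    Fin (Module.finrank ℂ S) → TangentSpace 𝓘(ℂ, E) x :=
  (h.exists_isUnitaryBasis x S).choose

/-- `R(Σ; u, ū) = ∑ᵢ R(Eᵢ, Ēᵢ, u, ū)` for a unitary basis `Eᵢ` of `Σ` (a real number, as are the
two quantities below). -/
noncomputable def planeCurvature [FiniteDimensional ℂ E] (h : HermitianMetric E M) (x : M)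
    (S : Submodule ℂ (TangentSpace 𝓘(ℂ, E) x)) (u : TangentSpace 𝓘(ℂ, E) x) : ℝ :=
  (∑ i, h.curvature x (h.unitaryBasis x S i) (h.unitaryBasis x S i) u u).re

/-- The `k`-Ricci curvature `Ric_k(x, Σ)(X, X̄) = ∑ᵢ R(X, X̄, Eᵢ, Ēᵢ)`, where `k = dim Σ`. -/
noncomputable def kRicci [FiniteDimensional ℂ E] (h : HermitianMetric E M) (x : M)
    (S : Submodule ℂ (TangentSpace 𝓘(ℂ, E) x)) (X : TangentSpace 𝓘(ℂ, E) x) : ℝ :=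
  (∑ i, h.curvature x X X (h.unitaryBasis x S i) (h.unitaryBasis x S i)).re

/-- The `k`-scalar curvature `S_k(x, Σ) = ∑ᵢⱼ R(Eᵢ, Ēᵢ, Eⱼ, Ēⱼ)`, where `k = dim Σ`. -/
noncomputable def kScalar [FiniteDimensional ℂ E] (h : HermitianMetric E M) (x : M)
    (S : Submodule ℂ (TangentSpace 𝓘(ℂ, E) x)) : ℝ :=
  (∑ i, ∑ j, h.curvature x (h.unitaryBasis x S i) (h.unitaryBasis x S i)
    (h.unitaryBasis x S j) (h.unitaryBasis x S j)).re

/-- `Ric_k > 0`. -/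
def KRicciPos [FiniteDimensional ℂ E] (h : HermitianMetric E M) (k : ℕ) : Prop :=
  ∀ (x : M) (S : Submodule ℂ (TangentSpace 𝓘(ℂ, E) x)), Module.finrank ℂ S = k →
    ∀ X ∈ S, X ≠ 0 → 0 < h.kRicci x S X

/-- `Ric_k < 0`. -/
def KRicciNeg [FiniteDimensional ℂ E] (h : HermitianMetric E M) (k : ℕ) : Prop :=
  ∀ (x : M) (S : Submodule ℂ (TangentSpace 𝓘(ℂ, E) x)), Module.finrank ℂ S = k →
    ∀ X ∈ S, X ≠ 0 → h.kRicci x S X < 0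

/-- The holomorphic tangent bundle with the metric `h` is uniformly RC `k`-positive. -/
def UniformlyRCPos [FiniteDimensional ℂ E] (h : HermitianMetric E M) (k : ℕ) : Prop :=
  ∀ x : M, ∃ S : Submodule ℂ (TangentSpace 𝓘(ℂ, E) x), Module.finrank ℂ S = k ∧
    ∀ u : TangentSpace 𝓘(ℂ, E) x, u ≠ 0 → 0 < h.planeCurvature x S u

/-- The holomorphic tangent bundle with the metric `h` is uniformly RC `k`-negative. -/
def UniformlyRCNeg [FiniteDimensional ℂ E] (h : HermitianMetric E M) (k : ℕ) : Prop :=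
  ∀ x : M, ∃ S : Submodule ℂ (TangentSpace 𝓘(ℂ, E) x), Module.finrank ℂ S = k ∧
    ∀ u : TangentSpace 𝓘(ℂ, E) x, u ≠ 0 → h.planeCurvature x S u < 0

/-- The set of all values `Ric_k(x, Σ)(X, X̄)` with `dim Σ = k`, `X ∈ Σ` and `|X| = 1`. -/
def unitKRicciValues [FiniteDimensional ℂ E] (h : HermitianMetric E M) (k : ℕ) : Set ℝ :=
  {r | ∃ (x : M) (S : Submodule ℂ (TangentSpace 𝓘(ℂ, E) x)) (X : TangentSpace 𝓘(ℂ, E) x),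
    Module.finrank ℂ S = k ∧ X ∈ S ∧ h.normSq x X = 1 ∧ r = h.kRicci x S X}

/-- `Σ` is a `k`-plane at `x` minimizing `S_k(x, ·)` among all `k`-planes at `x`. -/
def MinimizesKScalar [FiniteDimensional ℂ E] (h : HermitianMetric E M) (k : ℕ) (x : M)
    (S : Submodule ℂ (TangentSpace 𝓘(ℂ, E) x)) : Prop :=
  Module.finrank ℂ S = k ∧
    ∀ T : Submodule ℂ (TangentSpace 𝓘(ℂ, E) x), Module.finrank ℂ T = k →
      h.kScalar x S ≤ h.kScalar x T

/-- `Σ` is a `k`-plane at `x` maximizing `S_k(x, ·)` among all `k`-planes at `x`. -/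
def MaximizesKScalar [FiniteDimensional ℂ E] (h : HermitianMetric E M) (k : ℕ) (x : M)
    (S : Submodule ℂ (TangentSpace 𝓘(ℂ, E) x)) : Prop :=
  Module.finrank ℂ S = k ∧
    ∀ T : Submodule ℂ (TangentSpace 𝓘(ℂ, E) x), Module.finrank ℂ T = k →
      h.kScalar x T ≤ h.kScalar x S

end HermitianMetric

/-! Fix x and let Σ minimize S_k(x,·), with unitary basis E_i. For W orthogonal to Σ, replace E_i by
(E_i + tW)/√(1 + t²|W|²). The new frame is unitary, so S_k cannot drop. Multiplied by (1 + t²|W|²)²,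
this says that a quartic polynomial in t, vanishing at 0, is nonnegative. Its linear coefficient
therefore vanishes and its quadratic one is nonnegative (`variation_of_minimal`).

Write Q(X,Y) = ∑_j R(X,Ȳ,E_j,Ē_j). The linear term, taken for W and for iW, gives Q(E_i,W) = 0. In
the quadratic term, averaging over W and iW cancels Re R(E_i,W̄,E_i,W̄), and what remains is |W|²
Q(E_i,E_i) ≤ R(E_i,Ē_i,W,W̄) + Q(W,W). Since Q(E_i,E_i) ≥ D, summing over i yields kD|W|² ≤ (k+1)
Q(W,W). For X = P + W with P ∈ Σ the cross terms of Q vanish and Q(P,P) ≥ D|P|², so Q(X,X) ≥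
kD/(k+1)|X|² because D ≥ 0 (`mul_le_of_minimal`). By the Kähler symmetries Q(X,X) is R(Σ;X,X̄). The
negative case is the same statement for −R.

Two analytic facts are needed. The Chern curvature must be Hermitian; this follows from ⟨R_{XȲ}Z,W⟩
= ⟨Γ_X Z,Γ_Y W⟩ − ∂_Ȳ∂_X⟨Z,W⟩ and the symmetry of second derivatives (`inner_wirtingerBar`,
`localCurvature_conj`). The extrema must be attained; for D this requires continuity as x varies.
Since the curvature at x is defined in the chart around x, it is first shown to be independent of
the chart (`localCurvature_eq`). Unitary frames over a compact piece of a chart form a compact set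
(`isCompact_unitaryFrames`), and finitely many such pieces cover M. -/

/-! ### Unitary frames and traces of sesquilinear forms -/

section UnitaryFrames

variable {V : Type*} [AddCommGroup V] [Module ℂ V]

/-- The vectors `e i` are unitary for the form `B`. -/
def IsUnitaryFrame (B : V →ₗ[ℂ] V →ₗ⋆[ℂ] ℂ) {k : ℕ} (e : Fin k → V) : Prop :=
  ∀ i j, B (e i) (e j) = if i = j then 1 else 0

theorem IsUnitaryFrame.sum_smul_eq {B : V →ₗ[ℂ] V →ₗ⋆[ℂ] ℂ} {k : ℕ} {e : Fin k → V}
    (he : IsUnitaryFrame B e) {X : V} (hX : X ∈ Submodule.span ℂ (Set.range e)) :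
    ∑ j, B X (e j) • e j = X := by
  obtain ⟨c, rfl⟩ := (Submodule.mem_span_range_iff_exists_fun ℂ).1 hX
  refine Finset.sum_congr rfl fun j _ => ?_
  congr 1
  simp [he _ _]

theorem IsUnitaryFrame.linearIndependent {B : V →ₗ[ℂ] V →ₗ⋆[ℂ] ℂ} {k : ℕ} {e : Fin k → V}
    (he : IsUnitaryFrame B e) : LinearIndependent ℂ e := by
  rw [Fintype.linearIndependent_iff]
  intro c hc i
  have h1 : B (∑ j, c j • e j) (e i) = c i := by simp [he _ _]
  rw [← h1, hc]
  simp

theorem IsUnitaryFrame.finrank_span {B : V →ₗ[ℂ] V →ₗ⋆[ℂ] ℂ} {k : ℕ} {e : Fin k → V}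
    (he : IsUnitaryFrame B e) : Module.finrank ℂ (Submodule.span ℂ (Set.range e)) = k := by
  rw [finrank_span_eq_card he.linearIndependent, Fintype.card_fin]

/-- Basis independence of the trace: expanding e_i along f in the first slot, and f_j along e in the
second, turns both sides into the double sum of B(e_i,f_j) Φ(f_j,e_i). -/
theorem sum_apply_self_eq_of_span_eq {B : V →ₗ[ℂ] V →ₗ⋆[ℂ] ℂ}
    (hsymm : ∀ v w, conj (B v w) = B w v) {k l : ℕ} {e : Fin k → V} {f : Fin l → V}
    (he : IsUnitaryFrame B e) (hf : IsUnitaryFrame B f)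
    (hspan : Submodule.span ℂ (Set.range e) = Submodule.span ℂ (Set.range f))
    (Φ : V →ₗ[ℂ] V →ₗ⋆[ℂ] ℂ) : ∑ i, Φ (e i) (e i) = ∑ j, Φ (f j) (f j) := by
  have h1 : ∀ i, Φ (e i) (e i) = ∑ j, B (e i) (f j) * Φ (f j) (e i) := fun i => by
    have h2 := hf.sum_smul_eq (X := e i) (hspan ▸ Submodule.subset_span ⟨i, rfl⟩)
    conv_lhs => rw [← h2]
    have h3 : ∀ w, Φ (∑ j, B (e i) (f j) • f j) w = ∑ j, B (e i) (f j) * Φ (f j) w := by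
      intro w; simp
    rw [h2, ← h3, h2]
  have h4 : ∀ j, Φ (f j) (f j) = ∑ i, B (e i) (f j) * Φ (f j) (e i) := fun j => by
    have h2 := he.sum_smul_eq (X := f j) (hspan ▸ Submodule.subset_span ⟨j, rfl⟩)
    have h3 : ∀ w, Φ w (∑ i, B (f j) (e i) • e i) = ∑ i, B (e i) (f j) * Φ w (e i) := by
      intro w; simp [hsymm]
    rw [← h3, h2]
  rw [Finset.sum_congr rfl fun i _ => h1 i, Finset.sum_congr rfl fun j _ => h4 j,
    Finset.sum_comm]

end UnitaryFrames

/-! ### Algebra of Kähler-like curvature tensors -/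

/-- Divide by t > 0 and let t → 0 to get a ≥ 0; the substitution t ↦ −t gives a ≤ 0. With a = 0,
dividing by t² gives b ≥ 0. -/
theorem eq_zero_and_nonneg_of_quartic_nonneg {a b c d : ℝ}
    (h : ∀ t : ℝ, 0 ≤ a * t + b * t ^ 2 + c * t ^ 3 + d * t ^ 4) : a = 0 ∧ 0 ≤ b := by
  have hlim : ∀ p q r s : ℝ, (∀ t : ℝ, 0 < t → 0 ≤ p + q * t + r * t ^ 2 + s * t ^ 3) → 0 ≤ p := by
    intro p q r s hp
    have h1 : Filter.Tendsto (fun t : ℝ => p + q * t + r * t ^ 2 + s * t ^ 3)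
        (nhdsWithin 0 (Set.Ioi 0)) (nhds p) := by
      have h2 : Continuous fun t : ℝ => p + q * t + r * t ^ 2 + s * t ^ 3 := by fun_prop
      have h3 := (h2.tendsto 0).mono_left (nhdsWithin_le_nhds (s := Set.Ioi 0))
      simpa using h3
    exact ge_of_tendsto h1 (Filter.eventually_of_mem self_mem_nhdsWithin fun t ht => hp t ht)
  have ha : 0 ≤ a := hlim a b c d fun t ht => by
    refine nonneg_of_mul_nonneg_right (b := _) (a := t) ?_ ht
    have := h t
    nlinarith
  have ha' : 0 ≤ -a := hlim (-a) b (-c) d fun t ht => by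
    refine nonneg_of_mul_nonneg_right (b := _) (a := t) ?_ ht
    have := h (-t)
    nlinarith
  have ha0 : a = 0 := by linarith
  refine ⟨ha0, hlim b c d 0 fun t ht => ?_⟩
  refine nonneg_of_mul_nonneg_right (b := _) (a := t ^ 2) ?_ (by positivity)
  have := h t
  rw [ha0] at this
  nlinarith

/-- The symmetries of the curvature tensor of a Kähler metric. -/
structure IsKahlerCurvatureTensor {V : Type*} [AddCommGroup V] [Module ℂ V]
    (R : V → V → V → V → ℂ) : Prop where
  add_left : ∀ X X' Y Z W, R (X + X') Y Z W = R X Y Z W + R X' Y Z W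
  smul_left : ∀ (a : ℂ) X Y Z W, R (a • X) Y Z W = a * R X Y Z W
  swap : ∀ X Y Z W, R X Y Z W = R Z Y X W
  conj_symm : ∀ X Y Z W, conj (R X Y Z W) = R Y X W Z

namespace IsKahlerCurvatureTensor

variable {V : Type*} [AddCommGroup V] [Module ℂ V] {R : V → V → V → V → ℂ}

theorem neg (hR : IsKahlerCurvatureTensor R) :
    IsKahlerCurvatureTensor fun X Y Z W => -R X Y Z W where
  add_left X X' Y Z W := by rw [hR.add_left, neg_add]
  smul_left a X Y Z W := by rw [hR.smul_left, mul_neg]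
  swap X Y Z W := by rw [hR.swap]
  conj_symm X Y Z W := by rw [map_neg, hR.conj_symm]

theorem swap' (hR : IsKahlerCurvatureTensor R) (X Y Z W : V) : R X Y Z W = R X W Z Y := by
  rw [← hR.conj_symm Y X W Z, hR.swap Y X W Z, hR.conj_symm]

theorem pair_symm (hR : IsKahlerCurvatureTensor R) (X Y Z W : V) : R X Y Z W = R Z W X Y := by
  rw [hR.swap, hR.swap']

theorem add₂ (hR : IsKahlerCurvatureTensor R) (X Y Y' Z W : V) :
    R X (Y + Y') Z W = R X Y Z W + R X Y' Z W := by
  rw [← hR.conj_symm, hR.add_left, map_add, hR.conj_symm, hR.conj_symm]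

theorem smul₂ (hR : IsKahlerCurvatureTensor R) (a : ℂ) (X Y Z W : V) :
    R X (a • Y) Z W = conj a * R X Y Z W := by
  rw [← hR.conj_symm, hR.smul_left, map_mul, hR.conj_symm]

theorem add₃ (hR : IsKahlerCurvatureTensor R) (X Y Z Z' W : V) :
    R X Y (Z + Z') W = R X Y Z W + R X Y Z' W := by
  rw [hR.swap, hR.add_left, hR.swap Z, hR.swap Z']

theorem smul₃ (hR : IsKahlerCurvatureTensor R) (a : ℂ) (X Y Z W : V) :
    R X Y (a • Z) W = a * R X Y Z W := by
  rw [hR.swap, hR.smul_left, hR.swap Z]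

theorem add₄ (hR : IsKahlerCurvatureTensor R) (X Y Z W W' : V) :
    R X Y Z (W + W') = R X Y Z W + R X Y Z W' := by
  rw [hR.swap', hR.add₂, hR.swap' X W, hR.swap' X W']

theorem smul₄ (hR : IsKahlerCurvatureTensor R) (a : ℂ) (X Y Z W : V) :
    R X Y Z (a • W) = conj a * R X Y Z W := by
  rw [hR.swap', hR.smul₂, hR.swap' X W]

/-- The sesquilinear form in the first two arguments of a curvature tensor. -/
def form (hR : IsKahlerCurvatureTensor R) (Z W : V) : V →ₗ[ℂ] V →ₗ⋆[ℂ] ℂ :=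
  LinearMap.mk₂'ₛₗ (RingHom.id ℂ) (starRingEnd ℂ) (fun X Y => R X Y Z W)
    (fun _ _ _ => hR.add_left _ _ _ _ _) (fun _ _ _ => hR.smul_left _ _ _ _ _)
    (fun _ _ _ => hR.add₂ _ _ _ _ _) (fun _ _ _ => hR.smul₂ _ _ _ _ _)

theorem form_apply (hR : IsKahlerCurvatureTensor R) (X Y Z W : V) :
    hR.form Z W X Y = R X Y Z W := rfl

section

variable {B : V →ₗ[ℂ] V →ₗ⋆[ℂ] ℂ} {k l : ℕ} {e : Fin k → V} {f : Fin l → V}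

theorem sum_frame_left (hR : IsKahlerCurvatureTensor R) (hsymm : ∀ v w, conj (B v w) = B w v)
    (he : IsUnitaryFrame B e) (hf : IsUnitaryFrame B f)
    (hspan : Submodule.span ℂ (Set.range e) = Submodule.span ℂ (Set.range f)) (Z W : V) :
    ∑ i, R (e i) (e i) Z W = ∑ j, R (f j) (f j) Z W :=
  sum_apply_self_eq_of_span_eq hsymm he hf hspan (hR.form Z W)

theorem sum_frame_right (hR : IsKahlerCurvatureTensor R) (hsymm : ∀ v w, conj (B v w) = B w v)
    (he : IsUnitaryFrame B e) (hf : IsUnitaryFrame B f)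
    (hspan : Submodule.span ℂ (Set.range e) = Submodule.span ℂ (Set.range f)) (X Y : V) :
    ∑ i, R X Y (e i) (e i) = ∑ j, R X Y (f j) (f j) := by
  simp only [hR.pair_symm X Y]
  exact hR.sum_frame_left hsymm he hf hspan X Y

theorem sum_sum_frame (hR : IsKahlerCurvatureTensor R) (hsymm : ∀ v w, conj (B v w) = B w v)
    (he : IsUnitaryFrame B e) (hf : IsUnitaryFrame B f)
    (hspan : Submodule.span ℂ (Set.range e) = Submodule.span ℂ (Set.range f)) :
    ∑ i, ∑ j, R (e i) (e i) (e j) (e j) = ∑ i, ∑ j, R (f i) (f i) (f j) (f j) := by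
  simp only [hR.sum_frame_right hsymm he hf hspan]
  rw [Finset.sum_comm, Finset.sum_comm (f := fun i j => R (f i) (f i) (f j) (f j))]
  simp only [hR.sum_frame_left hsymm he hf hspan]

end

/-- Of the six terms in t², four contain W once barred and once unbarred, and all equal R(E,Ē,W,W̄)
by the symmetries. The other two are R(E,W̄,E,W̄) and its conjugate. -/
theorem re_apply_add_smul (hR : IsKahlerCurvatureTensor R) (E W : V) (t : ℝ) :
    (R (E + (t : ℂ) • W) (E + (t : ℂ) • W) (E + (t : ℂ) • W) (E + (t : ℂ) • W)).re =
      (R E E E E).re + 4 * (R E W E E).re * t +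
      (4 * (R E E W W).re + 2 * (R E W E W).re) * t ^ 2 + 4 * (R E W W W).re * t ^ 3 +
      (R W W W W).re * t ^ 4 := by
  have hc : ∀ X Y Z T, (R X Y Z T).re = (R Y X T Z).re := fun X Y Z T => by
    rw [← hR.conj_symm, Complex.conj_re]
  simp only [hR.add_left, hR.smul_left, hR.add₂, hR.smul₂, hR.add₃, hR.smul₃, hR.add₄, hR.smul₄,
    Complex.conj_ofReal, Complex.add_re, Complex.re_ofReal_mul]
  have h1 : (R E E W E).re = (R E W E E).re := by rw [hc, hR.swap']
  have h2 : (R E W W E).re = (R E E W W).re := by rw [hR.swap']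
  have h3 : (R W E E W).re = (R E E W W).re := by rw [hR.swap]
  have h4 : (R W W E E).re = (R E E W W).re := by rw [hR.pair_symm]
  have h5 : (R W W E W).re = (R E W W W).re := by rw [hR.swap]
  have h6 : (R W W W E).re = (R E W W W).re := by rw [hc, hR.swap', hR.swap, hc, hR.swap', hc, hR.swap]
  rw [hR.swap' E E E W, hR.swap W E E E, h1, h2, h3, h4, h5, h6, hc W E W E, hc W E W W]
  ring

/-! ### First and second variation of the k-scalar curvature -/

section Variation

variable {B : V →ₗ[ℂ] V →ₗ⋆[ℂ] ℂ} {k : ℕ} {e : Fin k → V}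

theorem sum_sum_update (hR : IsKahlerCurvatureTensor R) (e : Fin k → V) (i : Fin k) (u : V) :
    ∑ a, ∑ b, R (Function.update e i u a) (Function.update e i u a)
        (Function.update e i u b) (Function.update e i u b) =
      R u u u u + 2 * ∑ b ∈ Finset.univ.erase i, R u u (e b) (e b) +
        ∑ a ∈ Finset.univ.erase i, ∑ b ∈ Finset.univ.erase i, R (e a) (e a) (e b) (e b) := by
  have h1 : ∀ F : V → ℂ, ∑ a, F (Function.update e i u a) =
      F u + ∑ a ∈ Finset.univ.erase i, F (e a) := by
    intro F
    rw [← Finset.add_sum_erase _ _ (Finset.mem_univ i), Function.update_self]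
    congr 1
    refine Finset.sum_congr rfl fun a ha => ?_
    rw [Function.update_of_ne (Finset.ne_of_mem_erase ha)]
  have h2 : ∀ X, ∑ b, R X X (Function.update e i u b) (Function.update e i u b) =
      R X X u u + ∑ b ∈ Finset.univ.erase i, R X X (e b) (e b) := fun X => h1 fun Y => R X X Y Y
  simp only [h2]
  rw [h1 fun X => R X X u u + ∑ b ∈ Finset.univ.erase i, R X X (e b) (e b),
    Finset.sum_add_distrib]
  simp only [fun a => hR.pair_symm (e a) (e a) u u]
  ring

/-- The first and second variation of the `k`-scalar curvature at a minimizing unitary frame,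
when `e i` is moved in the direction of a vector `W` orthogonal to the frame. -/
theorem variation_of_minimal (hR : IsKahlerCurvatureTensor R)
    (hsymm : ∀ v w, conj (B v w) = B w v) (hnonneg : ∀ v, 0 ≤ (B v v).re)
    (he : IsUnitaryFrame B e)
    (hmin : ∀ f : Fin k → V, IsUnitaryFrame B f →
      (∑ a, ∑ b, R (e a) (e a) (e b) (e b)).re ≤ (∑ a, ∑ b, R (f a) (f a) (f b) (f b)).re)
    {W : V} (hW : ∀ j, B W (e j) = 0) (i : Fin k) :
    (∑ j, R (e i) W (e j) (e j)).re = 0 ∧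
    0 ≤ 2 * (R (e i) (e i) W W).re + (R (e i) W (e i) W).re +
      (∑ j ∈ Finset.univ.erase i, R W W (e j) (e j)).re -
      (B W W).re * (∑ j, R (e i) (e i) (e j) (e j)).re := by
  set m := (B W W).re with hm
  set Q : V → V → ℂ := fun X Y => ∑ j ∈ Finset.univ.erase i, R X Y (e j) (e j) with hQ
  have hsplit : ∀ X Y, ∑ j, R X Y (e j) (e j) = R X Y (e i) (e i) + Q X Y := fun X Y =>
    (Finset.add_sum_erase _ _ (Finset.mem_univ i)).symm
  have hBW : B W W = (m : ℂ) := (Complex.conj_eq_iff_re.1 (hsymm W W)).symm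
  have hW' : ∀ j, B (e j) W = 0 := fun j => by rw [← hsymm, hW, map_zero]
  have hm0 : 0 ≤ m := hnonneg W
  -- Q is Hermitian, so its two cross terms have the same real part.
  have hQv : ∀ t : ℝ, (Q (e i + (t : ℂ) • W) (e i + (t : ℂ) • W)).re =
      (Q (e i) (e i)).re + 2 * (Q (e i) W).re * t + (Q W W).re * t ^ 2 := by
    intro t
    have h1 : (Q W (e i)).re = (Q (e i) W).re := by
      simp only [hQ, Complex.re_sum]
      refine Finset.sum_congr rfl fun j _ => ?_
      rw [← hR.conj_symm, Complex.conj_re]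
    have h2 : Q (e i + (t : ℂ) • W) (e i + (t : ℂ) • W) =
        Q (e i) (e i) + t * Q (e i) W + t * (Q W (e i) + t * Q W W) := by
      simp only [hQ, hR.add_left, hR.smul_left, hR.add₂, hR.smul₂, Complex.conj_ofReal,
        Finset.sum_add_distrib, Finset.mul_sum, mul_add]
    rw [h2]
    simp only [Complex.add_re, Complex.re_ofReal_mul, h1]
    ring
  -- The quartic is N² times the difference of the k-scalar curvatures of the rotated and the
  -- original frame, where N = 1 + t²|W|². The terms not involving index i cancel.
  have hkey : ∀ t : ℝ, 0 ≤ 4 * (∑ j, R (e i) W (e j) (e j)).re * t +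
      2 * (2 * (R (e i) (e i) W W).re + (R (e i) W (e i) W).re + (Q W W).re -
        m * (∑ j, R (e i) (e i) (e j) (e j)).re) * t ^ 2 +
      4 * ((R (e i) W W W).re + m * (Q (e i) W).re) * t ^ 3 +
      ((R W W W W).re + 2 * m * (Q W W).re -
        m ^ 2 * ((R (e i) (e i) (e i) (e i)).re + 2 * (Q (e i) (e i)).re)) * t ^ 4 := by
    intro t
    set N : ℝ := 1 + t ^ 2 * m with hN
    have hNpos : 0 < N := by positivity
    set v : V := e i + (t : ℂ) • W with hv
    have hBvv : B v v = (N : ℂ) := by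
      simp only [hv, map_add, map_smul, LinearMap.add_apply, LinearMap.smul_apply,
        LinearMap.map_smulₛₗ, Complex.conj_ofReal, he _ _, hW, hW', hBW, smul_eq_mul, hN]
      push_cast
      simp
      ring
    set s : ℝ := (Real.sqrt N)⁻¹ with hs
    have hs2 : s * s = N⁻¹ := by
      rw [hs, ← mul_inv, Real.mul_self_sqrt hNpos.le]
    have hBe : ∀ j, j ≠ i → B v (e j) = 0 := fun j hj => by
      simp [hv, he _ _, hW, hj.symm]
    have hBe' : ∀ j, j ≠ i → B (e j) v = 0 := fun j hj => by
      rw [← hsymm, hBe j hj, map_zero]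
    have hf : IsUnitaryFrame B (Function.update e i ((s : ℂ) • v)) := by
      intro a b
      by_cases ha : a = i <;> by_cases hb : b = i
      · subst ha; subst hb
        simp only [Function.update_self, map_smul, LinearMap.smul_apply, LinearMap.map_smulₛₗ,
          Complex.conj_ofReal, smul_eq_mul, hBvv, if_true]
        rw [← mul_assoc, ← Complex.ofReal_mul, ← Complex.ofReal_mul, hs2,
          inv_mul_cancel₀ hNpos.ne', Complex.ofReal_one]
      · subst ha
        simp [Function.update_of_ne hb, hBe b hb, Ne.symm hb]
      · subst hb
        simp only [Function.update_self, Function.update_of_ne ha, LinearMap.map_smulₛₗ, hBe' a ha,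
          smul_zero, if_neg ha]
      · rw [Function.update_of_ne ha, Function.update_of_ne hb, he]
    have h1 := hmin _ hf
    have h2 := hR.sum_sum_update e i (e i)
    rw [Function.update_eq_self] at h2
    rw [h2, hR.sum_sum_update e i] at h1
    have h3 : R ((s : ℂ) • v) ((s : ℂ) • v) ((s : ℂ) • v) ((s : ℂ) • v) =
        ((N⁻¹ * N⁻¹ : ℝ) : ℂ) * R v v v v := by
      rw [hR.smul_left, hR.smul₂, hR.smul₃, hR.smul₄, ← hs2]
      simp only [Complex.conj_ofReal]
      push_cast
      ring
    have h4 : ∑ b ∈ Finset.univ.erase i, R ((s : ℂ) • v) ((s : ℂ) • v) (e b) (e b) =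
        ((N⁻¹ : ℝ) : ℂ) * Q v v := by
      simp only [hR.smul_left, hR.smul₂, Complex.conj_ofReal, hQ, Finset.mul_sum, ← hs2]
      push_cast
      simp only [mul_assoc]
    rw [h3, h4] at h1
    have h5 : ∑ b ∈ Finset.univ.erase i, R (e i) (e i) (e b) (e b) = Q (e i) (e i) := rfl
    rw [h5] at h1
    have h2re : ∀ z : ℂ, (2 * z).re = 2 * z.re := fun z => by simp
    simp only [Complex.add_re, h2re, Complex.re_ofReal_mul] at h1
    have h6 : N ^ 2 * ((R (e i) (e i) (e i) (e i)).re + 2 * (Q (e i) (e i)).re) ≤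
        (R v v v v).re + 2 * N * (Q v v).re := by
      have h7 : N ^ 2 * ((R (e i) (e i) (e i) (e i)).re + 2 * (Q (e i) (e i)).re) ≤
        N ^ 2 * (N⁻¹ * N⁻¹ * (R v v v v).re + 2 * (N⁻¹ * (Q v v).re)) :=
        mul_le_mul_of_nonneg_left (by linarith) (by positivity)
      refine h7.trans_eq ?_
      field_simp
    rw [hR.re_apply_add_smul, hQv] at h6
    simp only [hsplit, Complex.add_re]
    rw [hR.pair_symm (e i) W (e i) (e i), hR.swap' (e i) (e i) (e i) W]
    rw [hN] at h6
    linarith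
  obtain ⟨h1, h2⟩ := eq_zero_and_nonneg_of_quartic_nonneg hkey
  exact ⟨by linarith, by linarith⟩

/-- Split X into its component P in the span and its orthogonal component W. The first variation
decouples the two, the second bounds the contribution of W, and the Ricci hypothesis bounds that of
P. -/
theorem mul_le_of_minimal (hR : IsKahlerCurvatureTensor R)
    (hsymm : ∀ v w, conj (B v w) = B w v) (hnonneg : ∀ v, 0 ≤ (B v v).re)
    (he : IsUnitaryFrame B e)
    (hmin : ∀ f : Fin k → V, IsUnitaryFrame B f →
      (∑ a, ∑ b, R (e a) (e a) (e b) (e b)).re ≤ (∑ a, ∑ b, R (f a) (f a) (f b) (f b)).re)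
    {D : ℝ} (hD : 0 ≤ D)
    (hRic : ∀ X ∈ Submodule.span ℂ (Set.range e),
      D * (B X X).re ≤ (∑ i, R X X (e i) (e i)).re) (X : V) :
    k * D / (k + 1) * (B X X).re ≤ (∑ i, R (e i) (e i) X X).re := by
  set Q : V → V → ℂ := fun X Y => ∑ j, R X Y (e j) (e j) with hQ
  set P : V := ∑ j, B X (e j) • e j with hP
  set W : V := X - P with hWdef
  have hPmem : P ∈ Submodule.span ℂ (Set.range e) :=
    Submodule.sum_mem _ fun j _ => Submodule.smul_mem _ _ (Submodule.subset_span ⟨j, rfl⟩)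
  have hW : ∀ j, B W (e j) = 0 := fun j => by
    simp [hWdef, hP, he _ _]
  have hW' : ∀ j, B (e j) W = 0 := fun j => by rw [← hsymm, hW, map_zero]
  -- The direction iW is admissible too. It supplies the imaginary part of the first variation, and
  -- it reverses the sign of Re R(e_i,W̄,e_i,W̄) in the second.
  have hIW : ∀ j, B (Complex.I • W) (e j) = 0 := fun j => by simp [hW]
  have hcross : ∀ i, Q (e i) W = 0 := fun i => by
    refine Complex.ext ?_ ?_
    · exact (hR.variation_of_minimal hsymm hnonneg he hmin hW i).1
    · have h1 := (hR.variation_of_minimal hsymm hnonneg he hmin hIW i).1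
      simp only [hR.smul₂, ← Finset.mul_sum] at h1
      simpa [hQ] using h1
  have hPW : Q P W = 0 := by
    have h1 : ∀ Y, Q P Y = ∑ j, B X (e j) * Q (e j) Y := fun Y => by
      simp only [hQ, Finset.mul_sum]
      rw [Finset.sum_comm]
      refine Finset.sum_congr rfl fun j _ => ?_
      rw [← hR.form_apply, hP]
      simp [hR.form_apply]
    rw [h1]
    simp [hcross]
  have hWP : (Q W P).re = 0 := by
    have h1 : (Q W P).re = (Q P W).re := by
      simp only [hQ, Complex.re_sum]
      refine Finset.sum_congr rfl fun j _ => ?_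
      rw [← hR.conj_symm, Complex.conj_re]
    rw [h1, hPW, Complex.zero_re]
  have hX : X = P + W := by rw [hWdef]; abel
  have hBPW : B P W = 0 := by simp [hP, hW']
  have hBWP : B W P = 0 := by rw [← hsymm, hBPW, map_zero]
  have hBX : (B X X).re = (B P P).re + (B W W).re := by
    rw [hX]
    simp [hBPW, hBWP]
  have hQX : (∑ i, R (e i) (e i) X X).re = (Q P P).re + (Q W W).re := by
    simp only [hR.pair_symm (e _) (e _)]
    have h1 : Q X X = Q P P + Q P W + (Q W P + Q W W) := by
      rw [hX]
      simp only [hQ, hR.add_left, hR.add₂, Finset.sum_add_distrib]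
    change (Q X X).re = _
    rw [h1, hPW]
    simp [hWP]
  have hQP : D * (B P P).re ≤ (Q P P).re := hRic P hPmem
  have hQW : k * D * (B W W).re ≤ (k + 1) * (Q W W).re := by
    -- Half the sum of the second variations along W and iW. The sum over j ≠ i equals Q(W,W) −
    -- R(e_i,ē_i,W,W̄), which leaves a single copy of R(e_i,ē_i,W,W̄). Summing over i then gives the
    -- factor k + 1.
    have h1 : ∀ i, D * (B W W).re ≤ (R (e i) (e i) W W).re + (Q W W).re := fun i => by
      have h2 := (hR.variation_of_minimal hsymm hnonneg he hmin hW i).2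
      have h3 := (hR.variation_of_minimal hsymm hnonneg he hmin hIW i).2
      have h4 : (∑ j ∈ Finset.univ.erase i, R W W (e j) (e j)).re =
          (Q W W).re - (R (e i) (e i) W W).re := by
        have h5 : Q W W = R W W (e i) (e i) + ∑ j ∈ Finset.univ.erase i, R W W (e j) (e j) :=
          (Finset.add_sum_erase _ _ (Finset.mem_univ i)).symm
        rw [hR.pair_symm (e i) (e i) W W, h5, Complex.add_re]
        ring
      simp only [hR.smul_left, hR.smul₂, hR.smul₃, hR.smul₄, map_smul, LinearMap.smul_apply,
        LinearMap.map_smulₛₗ, Complex.conj_I, smul_eq_mul, ← mul_assoc, Complex.I_mul_I,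
        neg_mul, mul_neg, neg_neg, one_mul, Complex.neg_re] at h3
      have h5 := hRic (e i) (Submodule.subset_span ⟨i, rfl⟩)
      rw [he i i, if_pos rfl, Complex.one_re, mul_one] at h5
      have h6 := mul_le_mul_of_nonneg_right h5 (hnonneg W)
      linarith
    have h2 := Finset.sum_le_sum fun i (_ : i ∈ Finset.univ) => h1 i
    have h7 : ∑ i, (R (e i) (e i) W W).re = (Q W W).re := by
      simp only [hR.pair_symm (e _) (e _)]
      exact (Complex.re_sum _ _).symm
    rw [Finset.sum_add_distrib, h7] at h2
    simp only [Finset.sum_const, Finset.card_univ, Fintype.card_fin, nsmul_eq_mul] at h2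
    linarith
  rw [hQX, hBX, div_mul_eq_mul_div, div_le_iff₀ (by positivity)]
  -- The component in the span has constant D, and D ≥ 0 allows weakening it to kD/(k+1).
  have h8 : 0 ≤ D * (B P P).re := mul_nonneg hD (hnonneg P)
  have h9 : (0 : ℝ) ≤ k := Nat.cast_nonneg k
  nlinarith [mul_le_mul_of_nonneg_left hQP (by positivity : (0 : ℝ) ≤ k + 1)]

end Variation

end IsKahlerCurvatureTensor

/-! ### Smooth families of bilinear maps and Wirtinger derivatives -/

section Bilinear

variable {E F : Type*} [NormedAddCommGroup E] [NormedSpace ℝ E] [FiniteDimensional ℝ E]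
  [NormedAddCommGroup F] [NormedSpace ℝ F]

/-- The continuous bilinear map with the values of `B` on the pairs of vectors of a basis. -/
noncomputable def bilinCLM (B : E → E → F) : E →L[ℝ] E →L[ℝ] F :=
  ∑ i, ∑ j, (ContinuousLinearMap.smulRightL ℝ E (E →L[ℝ] F)
    (LinearMap.toContinuousLinearMap ((Module.finBasis ℝ E).coord i)))
    ((ContinuousLinearMap.smulRightL ℝ E F
      (LinearMap.toContinuousLinearMap ((Module.finBasis ℝ E).coord j)))
      (B (Module.finBasis ℝ E i) (Module.finBasis ℝ E j)))

theorem bilinCLM_apply (B : E →ₗ[ℝ] E →ₗ[ℝ] F) (v w : E) :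
    bilinCLM (fun v w => B v w) v w = B v w := by
  have h1 : B v w = B (∑ i, (Module.finBasis ℝ E).repr v i • Module.finBasis ℝ E i)
      (∑ j, (Module.finBasis ℝ E).repr w j • Module.finBasis ℝ E j) := by
    rw [Module.Basis.sum_repr, Module.Basis.sum_repr]
  rw [h1]
  simp only [map_sum, map_smul, LinearMap.sum_apply, LinearMap.smul_apply]
  simp only [bilinCLM, sum_apply, ContinuousLinearMap.smulRightL_apply_apply,
    ContinuousLinearMap.smulRight_apply, LinearMap.coe_toContinuousLinearMap',
    Module.Basis.coord_apply, smul_apply, Finset.smul_sum]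
  rw [Finset.sum_comm]
  exact Finset.sum_congr rfl fun i _ => Finset.sum_congr rfl fun j _ => smul_comm _ _ _

/-- Only finitely many values of B enter, so smoothness of each component upgrades to smoothness as
a map into a space of operators. -/
theorem contDiffOn_bilinCLM {G : Type*} [NormedAddCommGroup G] [NormedSpace ℝ G]
    {B : G → E → E → F} {U : Set G} {n : WithTop ℕ∞}
    (hB : ∀ v w, ContDiffOn ℝ n (fun z => B z v w) U) :
    ContDiffOn ℝ n (fun z => bilinCLM (B z)) U := by
  unfold bilinCLM
  refine ContDiffOn.sum fun i _ => ContDiffOn.sum fun j _ => ?_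
  exact (ContinuousLinearMap.contDiff _).comp_contDiffOn
    ((ContinuousLinearMap.contDiff _).comp_contDiffOn (hB _ _))

end Bilinear

section Wirtinger

variable {E F : Type*} [NormedAddCommGroup E] [NormedSpace ℂ E]
  [NormedAddCommGroup F] [NormedSpace ℂ F]

theorem Filter.EventuallyEq.wirtingerBar_eq {f g : E → F} {z : E} (h : f =ᶠ[nhds z] g) (v : E) :
    wirtingerBar f z v = wirtingerBar g z v := by
  unfold wirtingerBar
  rw [h.fderiv_eq]

theorem Filter.EventuallyEq.wirtinger_eq {f g : E → F} {z : E} (h : f =ᶠ[nhds z] g) (v : E) :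
    wirtinger f z v = wirtinger g z v := by
  unfold wirtinger
  rw [h.fderiv_eq]

theorem HasFDerivAt.wirtingerBar_eq {f : E → F} {f' : E →L[ℝ] F} {z : E}
    (h : HasFDerivAt f f' z) (v : E) :
    wirtingerBar f z v = (1 / 2 : ℂ) • (f' v + Complex.I • f' (Complex.I • v)) := by
  rw [wirtingerBar, h.fderiv]

theorem HasFDerivAt.wirtinger_eq {f : E → F} {f' : E →L[ℝ] F} {z : E}
    (h : HasFDerivAt f f' z) (v : E) :
    wirtinger f z v = (1 / 2 : ℂ) • (f' v - Complex.I • f' (Complex.I • v)) := by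
  rw [wirtinger, h.fderiv]

end Wirtinger

/-! ### Chern connection and curvature of a metric on an open set -/

section LocalMetric

set_option maxSynthPendingDepth 3

variable {E : Type*} [NormedAddCommGroup E] [NormedSpace ℂ E]

/-- A smooth Hermitian metric on the open subset `U` of a complex vector space. -/
structure IsLocalMetric (A : E → E →L[ℝ] E →L[ℝ] ℂ) (U : Set E) : Prop where
  isOpen : IsOpen U
  smooth : ContDiffOn ℝ ∞ A U
  smul_left : ∀ z (a : ℂ) v w, A z (a • v) w = a * A z v w
  conj_symm : ∀ z v w, conj (A z v w) = A z w v
  pos : ∀ z ∈ U, ∀ v, v ≠ 0 → 0 < (A z v v).re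

/-- `Γ` is the connection form of the Chern connection of `A`. -/
def IsChernConnection (A : E → E →L[ℝ] E →L[ℝ] ℂ) (U : Set E) (Γ : E → E → E → E) : Prop :=
  ∀ z ∈ U, ∀ X Z W, A z (Γ z X Z) W = wirtinger (fun ζ => A ζ Z W) z X

/-- The bilinear form `∂_X ⟨Z, W⟩`, with values in the real dual via the real part. -/
noncomputable def chernForm (A : E → E →L[ℝ] E →L[ℝ] ℂ) (z : E) :
    E →L[ℝ] E →L[ℝ] E →L[ℝ] ℝ :=
  (1 / 2 : ℝ) •
    (((ContinuousLinearMap.compL ℝ E (E →L[ℝ] ℂ) (E →L[ℝ] ℝ))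
        (ContinuousLinearMap.compL ℝ E ℂ ℝ Complex.reCLM)) ∘L (fderiv ℝ A z) +
      ((ContinuousLinearMap.compL ℝ E (E →L[ℝ] ℂ) (E →L[ℝ] ℝ))
        (ContinuousLinearMap.compL ℝ E ℂ ℝ Complex.imCLM)) ∘L
          ((fderiv ℝ A z) ∘L (Complex.I • ContinuousLinearMap.id ℝ E)))

/-- The connection form of the Chern connection as a continuous bilinear map. -/
noncomputable def chernCLM (A : E → E →L[ℝ] E →L[ℝ] ℂ) (z : E) : E →L[ℝ] E →L[ℝ] E :=
  (ContinuousLinearMap.compL ℝ E (E →L[ℝ] ℝ) E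
    (ContinuousLinearMap.inverse ((ContinuousLinearMap.compL ℝ E ℂ ℝ Complex.reCLM) ∘L A z))) ∘L
      chernForm A z

/-- The curvature tensor `⟨Γ_X Z, Γ_Y W⟩ - ∂_Ȳ ∂_X ⟨Z, W⟩`. -/
noncomputable def localCurvature (A : E → E →L[ℝ] E →L[ℝ] ℂ) (z X Y Z W : E) : ℂ :=
  A z (chernCLM A z X Z) (chernCLM A z Y W) - (1 / 4 : ℂ) *
    (fderiv ℝ (fderiv ℝ A) z Y X Z W
      - Complex.I * fderiv ℝ (fderiv ℝ A) z Y (Complex.I • X) Z W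
      + Complex.I * fderiv ℝ (fderiv ℝ A) z (Complex.I • Y) X Z W
      + fderiv ℝ (fderiv ℝ A) z (Complex.I • Y) (Complex.I • X) Z W)

namespace IsLocalMetric

variable {A : E → E →L[ℝ] E →L[ℝ] ℂ} {U : Set E} {Γ : E → E → E → E}

theorem smul_right (hA : IsLocalMetric A U) (z : E) (a : ℂ) (v w : E) :
    A z v (a • w) = conj a * A z v w := by
  rw [← hA.conj_symm, hA.smul_left, map_mul, hA.conj_symm]

theorem contDiffOn_fderiv (hA : IsLocalMetric A U) : ContDiffOn ℝ ∞ (fderiv ℝ A) U :=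
  hA.smooth.fderiv_of_isOpen hA.isOpen (by simp)

theorem differentiableAt (hA : IsLocalMetric A U) {z : E} (hz : z ∈ U) :
    DifferentiableAt ℝ A z :=
  (hA.smooth.contDiffAt (hA.isOpen.mem_nhds hz)).differentiableAt (by simp)

theorem hasFDerivAt_apply (hA : IsLocalMetric A U) {z : E} (hz : z ∈ U) (Z W : E) :
    HasFDerivAt (fun ζ => A ζ Z W) (((fderiv ℝ A z).flip Z).flip W) z := by
  have h1 := ((hA.differentiableAt hz).hasFDerivAt.clm_apply (hasFDerivAt_const Z z)).clm_apply
    (hasFDerivAt_const W z)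
  refine h1.congr_fderiv ?_
  ext v
  simp

theorem wirtinger_apply (hA : IsLocalMetric A U) {z : E} (hz : z ∈ U) (X Z W : E) :
    wirtinger (fun ζ => A ζ Z W) z X =
      (1 / 2 : ℂ) * (fderiv ℝ A z X Z W - Complex.I * fderiv ℝ A z (Complex.I • X) Z W) := by
  rw [(hA.hasFDerivAt_apply hz Z W).wirtinger_eq]
  simp

theorem fderiv_symm (hA : IsLocalMetric A U) {z : E} (hz : z ∈ U) (X Z W : E) :
    conj (fderiv ℝ A z X Z W) = fderiv ℝ A z X W Z := by
  have h1 := (hA.hasFDerivAt_apply hz Z W)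
  have h2 := (Complex.conjCLE : ℂ →L[ℝ] ℂ).hasFDerivAt.comp z h1
  have h3 : (Complex.conjCLE : ℂ →L[ℝ] ℂ) ∘ (fun ζ => A ζ Z W) = fun ζ => A ζ W Z := by
    funext ζ
    exact hA.conj_symm ζ Z W
  rw [h3] at h2
  have h4 := h2.unique (hA.hasFDerivAt_apply hz W Z)
  exact DFunLike.congr_fun h4 X

theorem fderiv_smul_left (hA : IsLocalMetric A U) {z : E} (hz : z ∈ U) (a : ℂ) (X Z W : E) :
    fderiv ℝ A z X (a • Z) W = a * fderiv ℝ A z X Z W := by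
  have h1 := (hA.hasFDerivAt_apply hz Z W).const_mul a
  have h3 : (fun ζ => a * A ζ Z W) = fun ζ => A ζ (a • Z) W := by
    funext ζ
    rw [hA.smul_left]
  rw [h3] at h1
  have h4 := (hA.hasFDerivAt_apply hz (a • Z) W).unique h1
  exact DFunLike.congr_fun h4 X

theorem chernForm_apply (hA : IsLocalMetric A U) {z : E} (hz : z ∈ U) (X Z W : E) :
    chernForm A z X Z W = (wirtinger (fun ζ => A ζ Z W) z X).re := by
  rw [hA.wirtinger_apply hz]
  simp [chernForm]
  ring

/-- Positivity makes v ↦ Re A(v,·) injective, and E and its real dual have the same dimension.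
Inverting this operator solves for the connection in a way that visibly depends smoothly on the
point. -/
theorem exists_equiv [FiniteDimensional ℂ E] (hA : IsLocalMetric A U) {z : E} (hz : z ∈ U) :
    ∃ e : E ≃L[ℝ] (E →L[ℝ] ℝ),
      (e : E →L[ℝ] E →L[ℝ] ℝ) = (ContinuousLinearMap.compL ℝ E ℂ ℝ Complex.reCLM) ∘L A z := by
  have : FiniteDimensional ℝ E := FiniteDimensional.complexToReal E
  set a : E →L[ℝ] E →L[ℝ] ℝ := (ContinuousLinearMap.compL ℝ E ℂ ℝ Complex.reCLM) ∘L A z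
  have hinj : Function.Injective (a : E →ₗ[ℝ] (E →L[ℝ] ℝ)) := by
    refine (injective_iff_map_eq_zero _).2 fun v hv => ?_
    by_contra hne
    have h1 := hA.pos z hz v hne
    have h2 : a v v = 0 := by
      have h3 : a v = 0 := hv
      rw [h3]; rfl
    have h4 : a v v = (A z v v).re := rfl
    linarith
  have hfin : Module.finrank ℝ E = Module.finrank ℝ (E →L[ℝ] ℝ) := by
    rw [← (LinearMap.toContinuousLinearMap : (E →ₗ[ℝ] ℝ) ≃ₗ[ℝ] (E →L[ℝ] ℝ)).finrank_eq]
    exact (Subspace.dual_finrank_eq (K := ℝ) (V := E)).symm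
  refine ⟨(LinearEquiv.ofInjectiveOfFinrankEq _ hinj hfin).toContinuousLinearEquiv, ?_⟩
  ext v w
  rfl

/-- The real part of the defining equation, for all W, already determines Γ_X Z. -/
theorem chernCLM_eq [FiniteDimensional ℂ E] (hA : IsLocalMetric A U)
    (hΓ : IsChernConnection A U Γ) {z : E} (hz : z ∈ U) (X Z : E) :
    chernCLM A z X Z = Γ z X Z := by
  obtain ⟨e, he⟩ := hA.exists_equiv hz
  have h1 : chernCLM A z X Z = e.symm (chernForm A z X Z) := by
    simp only [chernCLM, ← he, ContinuousLinearMap.inverse_equiv]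
    rfl
  rw [h1, ContinuousLinearEquiv.symm_apply_eq]
  ext W
  rw [hA.chernForm_apply hz, ← hΓ z hz]
  have h2 : e (Γ z X Z) = (e : E →L[ℝ] E →L[ℝ] ℝ) (Γ z X Z) := rfl
  rw [h2, he]
  rfl

theorem contDiffOn_chernForm (hA : IsLocalMetric A U) : ContDiffOn ℝ ∞ (chernForm A) U := by
  unfold chernForm
  refine ContDiffOn.const_smul _ (ContDiffOn.add ?_ ?_)
  · exact contDiffOn_const.clm_comp hA.contDiffOn_fderiv
  · exact contDiffOn_const.clm_comp (hA.contDiffOn_fderiv.clm_comp contDiffOn_const)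

/-- Inversion of operators is smooth at invertible ones. -/
theorem contDiffOn_chernCLM [FiniteDimensional ℂ E] (hA : IsLocalMetric A U) :
    ContDiffOn ℝ ∞ (chernCLM A) U := by
  unfold chernCLM
  refine ContDiffOn.clm_comp ?_ hA.contDiffOn_chernForm
  refine (ContinuousLinearMap.contDiff _).comp_contDiffOn fun z hz => ?_
  have : CompleteSpace E := FiniteDimensional.complete ℂ E
  obtain ⟨e, he⟩ := hA.exists_equiv hz
  have h1 := contDiffAt_map_inverse (n := ∞) e
  rw [he] at h1
  exact h1.comp_contDiffWithinAt z (contDiffOn_const.clm_comp hA.smooth z hz)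

/-- Apply ∂_Ȳ to ⟨Γ_X Z,W⟩ = ∂_X⟨Z,W⟩ with the product rule. The term in which the metric is
differentiated is ⟨Γ_X Z,Γ_Y W⟩. -/
theorem inner_wirtingerBar [FiniteDimensional ℂ E] (hA : IsLocalMetric A U)
    (hΓ : IsChernConnection A U Γ) {z : E} (hz : z ∈ U) (X Y Z W : E) :
    A z (-wirtingerBar (fun ζ => Γ ζ X Z) z Y) W = localCurvature A z X Y Z W := by
  have hU : U ∈ nhds z := hA.isOpen.mem_nhds hz
  have hGd : HasFDerivAt (fun ζ => chernCLM A ζ X Z)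
      (((fderiv ℝ (chernCLM A) z).flip X).flip Z) z := by
    have h1 := ((hA.contDiffOn_chernCLM.contDiffAt hU).differentiableAt (by simp)).hasFDerivAt
    refine ((h1.clm_apply (hasFDerivAt_const X z)).clm_apply (hasFDerivAt_const Z z)).congr_fderiv ?_
    ext v
    simp
  set G := ((fderiv ℝ (chernCLM A) z).flip X).flip Z
  have h1 : wirtingerBar (fun ζ => Γ ζ X Z) z Y = wirtingerBar (fun ζ => chernCLM A ζ X Z) z Y :=
    Filter.EventuallyEq.wirtingerBar_eq
      (Filter.eventually_of_mem hU fun ζ hζ => (hA.chernCLM_eq hΓ hζ X Z).symm) Y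
  rw [h1, hGd.wirtingerBar_eq]
  have hD2 : HasFDerivAt (fderiv ℝ A) (fderiv ℝ (fderiv ℝ A) z) z :=
    ((hA.contDiffOn_fderiv.contDiffAt hU).differentiableAt (by simp)).hasFDerivAt
  have hD2' : ∀ X', HasFDerivAt (fun ζ => fderiv ℝ A ζ X' Z W)
      ((((fderiv ℝ (fderiv ℝ A) z).flip X').flip Z).flip W) z := by
    intro X'
    refine (((hD2.clm_apply (hasFDerivAt_const X' z)).clm_apply
      (hasFDerivAt_const Z z)).clm_apply (hasFDerivAt_const W z)).congr_fderiv ?_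
    ext v
    simp
  have hL : HasFDerivAt (fun ζ => A ζ (chernCLM A ζ X Z) W)
      ((((fderiv ℝ A z).flip (chernCLM A z X Z)) + (A z) ∘L G).flip W) z := by
    refine (((hA.differentiableAt hz).hasFDerivAt.clm_apply hGd).clm_apply
      (hasFDerivAt_const W z)).congr_fderiv ?_
    ext v
    simp [add_comm]
  have hRt := ((hD2' X).sub ((hD2' (Complex.I • X)).const_mul Complex.I)).const_mul (1 / 2 : ℂ)
  have heq : (fun ζ => A ζ (chernCLM A ζ X Z) W) =ᶠ[nhds z] fun ζ => (1 / 2 : ℂ) *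
      (fderiv ℝ A ζ X Z W - Complex.I * fderiv ℝ A ζ (Complex.I • X) Z W) := by
    refine Filter.eventually_of_mem hU fun ζ hζ => ?_
    change A ζ (chernCLM A ζ X Z) W = _
    rw [hA.chernCLM_eq hΓ hζ, hΓ ζ hζ]
    exact hA.wirtinger_apply hζ X Z W
  have h2 := hL.unique (hRt.congr_of_eventuallyEq heq)
  have h3 : ∀ v, fderiv ℝ A z v (chernCLM A z X Z) W + A z (G v) W =
      (1 / 2 : ℂ) * (fderiv ℝ (fderiv ℝ A) z v X Z W -
        Complex.I * fderiv ℝ (fderiv ℝ A) z v (Complex.I • X) Z W) := by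
    intro v
    have := DFunLike.congr_fun h2 v
    simpa using this
  -- The conjugate of the connection equation: the (0,1)-derivative of the metric is the adjoint of
  -- the (1,0)-derivative.
  have h4 : A z (chernCLM A z X Z) (chernCLM A z Y W) =
      (1 / 2 : ℂ) * (fderiv ℝ A z Y (chernCLM A z X Z) W +
        Complex.I * fderiv ℝ A z (Complex.I • Y) (chernCLM A z X Z) W) := by
    rw [← hA.conj_symm, hA.chernCLM_eq hΓ hz Y W, hΓ z hz, hA.wirtinger_apply hz]
    simp only [map_mul, map_sub, hA.fderiv_symm hz, Complex.conj_I]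
    simp [map_ofNat (starRingEnd ℂ) 2]
  have h5 := h3 Y
  have h6 := h3 (Complex.I • Y)
  rw [← neg_smul, hA.smul_left, map_add, add_apply, hA.smul_left, localCurvature, h4]
  linear_combination (-(1 / 2 : ℂ)) * h5 - (1 / 2 : ℂ) * Complex.I * h6 + (1 / 4 : ℂ) *
    (fderiv ℝ (fderiv ℝ A) z (Complex.I • Y) (Complex.I • X) Z W) * Complex.I_sq

/-- The quadratic term in Γ is visibly Hermitian. In the other one, conjugation exchanges ∂_Ȳ∂_X
with ∂_X̄∂_Y, up to the order of differentiation, which is immaterial. -/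
theorem localCurvature_conj [FiniteDimensional ℂ E] (hA : IsLocalMetric A U) {z : E} (hz : z ∈ U)
    (X Y Z W : E) : conj (localCurvature A z X Y Z W) = localCurvature A z Y X W Z := by
  have hU : U ∈ nhds z := hA.isOpen.mem_nhds hz
  have hsymm : ∀ a b, fderiv ℝ (fderiv ℝ A) z a b = fderiv ℝ (fderiv ℝ A) z b a :=
    fun a b => ((hA.smooth.contDiffAt hU).isSymmSndFDerivAt (by simp [minSmoothness_of_isRCLikeNormedField]; exact WithTop.coe_le_coe.2 le_top)).eq a b
  have hD2 : HasFDerivAt (fderiv ℝ A) (fderiv ℝ (fderiv ℝ A) z) z :=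
    ((hA.contDiffOn_fderiv.contDiffAt hU).differentiableAt (by simp)).hasFDerivAt
  have hD2' : ∀ X' Z W, HasFDerivAt (fun ζ => fderiv ℝ A ζ X' Z W)
      ((((fderiv ℝ (fderiv ℝ A) z).flip X').flip Z).flip W) z := by
    intro X' Z W
    refine (((hD2.clm_apply (hasFDerivAt_const X' z)).clm_apply
      (hasFDerivAt_const Z z)).clm_apply (hasFDerivAt_const W z)).congr_fderiv ?_
    ext v
    simp
  have hconj : ∀ a b Z W, conj (fderiv ℝ (fderiv ℝ A) z a b Z W) =
      fderiv ℝ (fderiv ℝ A) z a b W Z := by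
    intro a b Z W
    have h2 := (Complex.conjCLE : ℂ →L[ℝ] ℂ).hasFDerivAt.comp z (hD2' b Z W)
    have h3 : (Complex.conjCLE : ℂ →L[ℝ] ℂ) ∘ (fun ζ => fderiv ℝ A ζ b Z W) =ᶠ[nhds z]
        fun ζ => fderiv ℝ A ζ b W Z :=
      Filter.eventually_of_mem hU fun ζ hζ => hA.fderiv_symm hζ b Z W
    have h4 := (h2.congr_of_eventuallyEq h3.symm).unique (hD2' b W Z)
    exact DFunLike.congr_fun h4 a
  simp only [localCurvature, map_sub, map_mul, map_add, hconj, hA.conj_symm, Complex.conj_I]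
  rw [hsymm X Y, hsymm X (Complex.I • Y), hsymm (Complex.I • X) Y,
    hsymm (Complex.I • X) (Complex.I • Y)]
  simp [map_ofNat (starRingEnd ℂ) 4]
  ring

theorem continuousOn_localCurvature [FiniteDimensional ℂ E] (hA : IsLocalMetric A U)
    {T : Type*} [TopologicalSpace T] {s : Set T} {z X Y Z W : T → E} (hz : ContinuousOn z s)
    (hzU : ∀ t ∈ s, z t ∈ U) (hX : ContinuousOn X s) (hY : ContinuousOn Y s)
    (hZ : ContinuousOn Z s) (hW : ContinuousOn W s) :
    ContinuousOn (fun t => localCurvature A (z t) (X t) (Y t) (Z t) (W t)) s := by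
  have h1 : ContinuousOn (fun t => A (z t)) s := hA.smooth.continuousOn.comp hz hzU
  have h2 : ContinuousOn (fun t => chernCLM A (z t)) s :=
    hA.contDiffOn_chernCLM.continuousOn.comp hz hzU
  have h3 : ContinuousOn (fun t => fderiv ℝ (fderiv ℝ A) (z t)) s :=
    ((hA.contDiffOn_fderiv.fderiv_of_isOpen (m := ∞) hA.isOpen (by simp)).continuousOn).comp hz hzU
  have h4 : ∀ {X Y : T → E}, ContinuousOn X s → ContinuousOn Y s →
      ContinuousOn (fun t => fderiv ℝ (fderiv ℝ A) (z t) (Y t) (X t) (Z t) (W t)) s :=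
    fun hX hY => (((h3.clm_apply hY).clm_apply hX).clm_apply hZ).clm_apply hW
  have hIX : ContinuousOn (fun t => Complex.I • X t) s := hX.const_smul _
  have hIY : ContinuousOn (fun t => Complex.I • Y t) s := hY.const_smul _
  unfold localCurvature
  refine ContinuousOn.sub ?_ (continuousOn_const.mul ?_)
  · exact (h1.clm_apply ((h2.clm_apply hX).clm_apply hZ)).clm_apply
      ((h2.clm_apply hY).clm_apply hW)
  · exact (((h4 hX hY).sub (continuousOn_const.mul (h4 hIX hY))).add
      (continuousOn_const.mul (h4 hX hIY))).add (h4 hIX hIY)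

end IsLocalMetric

end LocalMetric

/-! ### Invariance of the curvature under holomorphic isometries -/

section LocalMetricTransition

set_option maxSynthPendingDepth 3

variable {E : Type*} [NormedAddCommGroup E] [NormedSpace ℂ E]
  {A : E → E →L[ℝ] E →L[ℝ] ℂ} {U : Set E} {Γ : E → E → E → E}

theorem IsLocalMetric.ext_of_forall (hA : IsLocalMetric A U) {z : E} (hz : z ∈ U) {u u' : E}
    (h : ∀ W, A z u W = A z u' W) : u = u' := by
  by_contra hne
  have h1 := hA.pos z hz (u - u') (sub_ne_zero.2 hne)
  have h2 : A z (u - u') (u - u') = 0 := by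
    rw [map_sub (A z), sub_apply, h, sub_self]
  rw [h2, Complex.zero_re] at h1
  exact h1.false

theorem IsLocalMetric.chernCLM_I_smul_left [FiniteDimensional ℂ E] (hA : IsLocalMetric A U)
    (hΓ : IsChernConnection A U Γ) {z : E} (hz : z ∈ U) (X Z : E) :
    chernCLM A z (Complex.I • X) Z = Complex.I • chernCLM A z X Z := by
  refine hA.ext_of_forall hz fun W => ?_
  rw [hA.smul_left, hA.chernCLM_eq hΓ hz, hA.chernCLM_eq hΓ hz, hΓ z hz, hΓ z hz,
    hA.wirtinger_apply hz, hA.wirtinger_apply hz, smul_smul, Complex.I_mul_I, neg_one_smul]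
  simp only [map_neg, neg_apply]
  linear_combination (-(1 / 2 : ℂ)) * fderiv ℝ A z (Complex.I • X) Z W *
    (-Complex.I_sq)

theorem IsLocalMetric.chernCLM_I_smul_right [FiniteDimensional ℂ E] (hA : IsLocalMetric A U)
    (hΓ : IsChernConnection A U Γ) {z : E} (hz : z ∈ U) (X Z : E) :
    chernCLM A z X (Complex.I • Z) = Complex.I • chernCLM A z X Z := by
  refine hA.ext_of_forall hz fun W => ?_
  rw [hA.smul_left, hA.chernCLM_eq hΓ hz, hA.chernCLM_eq hΓ hz, hΓ z hz, hΓ z hz,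
    hA.wirtinger_apply hz, hA.wirtinger_apply hz, hA.fderiv_smul_left hz, hA.fderiv_smul_left hz]
  ring

/-- `τ` is a holomorphic isometry, with derivative `J`, from the metric `A` on the open set `V`
to the metric `A'` on `U'`. -/
structure IsHolomorphicIsometry (A A' : E → E →L[ℝ] E →L[ℝ] ℂ) (V U' : Set E) (τ : E → E)
    (J : E → E →L[ℂ] E) : Prop where
  isOpen : IsOpen V
  mapsTo : Set.MapsTo τ V U'
  hasFDerivAt : ∀ ζ ∈ V, HasFDerivAt τ (J ζ) ζ
  smooth : ContDiffOn ℂ ∞ J V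
  isometry : ∀ ζ ∈ V, ∀ v w, A ζ v w = A' (τ ζ) (J ζ v) (J ζ w)
  surjective : ∀ ζ ∈ V, Function.Surjective (J ζ)

namespace IsHolomorphicIsometry

variable {A' : E → E →L[ℝ] E →L[ℝ] ℂ} {V U' : Set E} {τ : E → E} {J : E → E →L[ℂ] E}
  {Γ' : E → E → E → E}

theorem hasFDerivAt_real (hτ : IsHolomorphicIsometry A A' V U' τ J) {z : E} (hz : z ∈ V) :
    HasFDerivAt τ ((J z).restrictScalars ℝ) z :=
  (hτ.hasFDerivAt z hz).restrictScalars ℝ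

theorem hasFDerivAt_apply_const (hτ : IsHolomorphicIsometry A A' V U' τ J) {z : E} (hz : z ∈ V)
    (Z : E) : HasFDerivAt (fun ζ => J ζ Z) (((fderiv ℂ J z).flip Z).restrictScalars ℝ) z := by
  have h1 := ((hτ.smooth.contDiffAt (hτ.isOpen.mem_nhds hz)).differentiableAt
    (by simp)).hasFDerivAt
  refine HasFDerivAt.restrictScalars ℝ ((h1.clm_apply (hasFDerivAt_const Z z)).congr_fderiv ?_)
  ext v
  simp

theorem hasFDerivAt_fderiv_apply_const (hτ : IsHolomorphicIsometry A A' V U' τ J) {z : E}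
    (hz : z ∈ V) (X Z : E) : HasFDerivAt (fun ζ => fderiv ℂ J ζ X Z)
      ((((fderiv ℂ (fderiv ℂ J) z).flip X).flip Z).restrictScalars ℝ) z := by
  have h0 : ContDiffOn ℂ ∞ (fderiv ℂ J) V := hτ.smooth.fderiv_of_isOpen hτ.isOpen (by simp)
  have h1 := ((h0.contDiffAt (hτ.isOpen.mem_nhds hz)).differentiableAt (by simp)).hasFDerivAt
  refine HasFDerivAt.restrictScalars ℝ (((h1.clm_apply (hasFDerivAt_const X z)).clm_apply
    (hasFDerivAt_const Z z)).congr_fderiv ?_)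
  ext v
  simp

/-- Product rule for a factor f that is only real differentiable, as the connection coefficients
are. -/
theorem exists_hasFDerivAt_apply (hτ : IsHolomorphicIsometry A A' V U' τ J) {z : E} (hz : z ∈ V)
    {f : E → E} {f' : E →L[ℝ] E} (hf : HasFDerivAt f f' z) :
    ∃ L : E →L[ℝ] E, HasFDerivAt (fun ζ => J ζ (f ζ)) L z ∧
      ∀ v, L v = fderiv ℂ J z v (f z) + J z (f' v) := by
  have h1 := ((hτ.smooth.contDiffAt (hτ.isOpen.mem_nhds hz)).differentiableAt
    (by simp)).hasFDerivAt.restrictScalars ℝ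
  have h2 := ((ContinuousLinearMap.restrictScalarsL ℂ E E ℝ ℝ).hasFDerivAt.comp z h1).clm_apply hf
  refine ⟨_, h2, fun v => ?_⟩
  simp [add_comm]

/-- Take ∂_X of the isometry identity. The derivative of J in the conjugate-linear slot drops out
because J is holomorphic; the one in the linear slot gives the inhomogeneous term. Surjectivity of J
makes the vectors JW sufficient as test vectors. -/
theorem map_connection (hτ : IsHolomorphicIsometry A A' V U' τ J)
    (hA' : IsLocalMetric A' U') (hVU : V ⊆ U) (hΓ : IsChernConnection A U Γ)
    (hΓ' : IsChernConnection A' U' Γ') {z : E} (hz : z ∈ V) (X Z : E) :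
    J z (Γ z X Z) = Γ' (τ z) (J z X) (J z Z) + fderiv ℂ J z X Z := by
  have hz' := hτ.mapsTo hz
  refine hA'.ext_of_forall hz' fun W' => ?_
  obtain ⟨W, rfl⟩ := hτ.surjective z hz W'
  have h1 : wirtinger (fun ζ => A ζ Z W) z X =
      wirtinger (fun ζ => A' (τ ζ) (J ζ Z) (J ζ W)) z X :=
    Filter.EventuallyEq.wirtinger_eq (Filter.eventually_of_mem (hτ.isOpen.mem_nhds hz)
      fun ζ hζ => hτ.isometry ζ hζ Z W) X
  have h2 := ((((hA'.differentiableAt hz').hasFDerivAt.comp z (hτ.hasFDerivAt_real hz)).clm_apply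
    (hτ.hasFDerivAt_apply_const hz Z)).clm_apply (hτ.hasFDerivAt_apply_const hz W)).wirtinger_eq X
  rw [← hτ.isometry z hz, hΓ z (hVU hz), h1, map_add, add_apply, hΓ' _ hz',
    hA'.wirtinger_apply hz']
  refine h2.trans ?_
  simp only [add_apply, ContinuousLinearMap.comp_apply, ContinuousLinearMap.flip_apply,
    ContinuousLinearMap.coe_restrictScalars', Function.comp_apply, map_smul, hA'.smul_left, hA'.smul_right, Complex.conj_I, smul_eq_mul]
  linear_combination (1 / 2 : ℂ) * (A' (τ z) (J z Z) (fderiv ℂ J z X W) -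
    A' (τ z) (fderiv ℂ J z X Z) (J z W)) * Complex.I_sq

/-- Apply ∂̄ to the transformation law of the connection. Everything in which J or its derivative is
differentiated is complex linear in the direction, so ∂̄ kills it, and the curvature transforms as a
tensor. -/
theorem localCurvature_eq [FiniteDimensional ℂ E] (hτ : IsHolomorphicIsometry A A' V U' τ J)
    (hA : IsLocalMetric A U) (hA' : IsLocalMetric A' U') (hVU : V ⊆ U)
    (hΓ : IsChernConnection A U Γ) (hΓ' : IsChernConnection A' U' Γ') {z : E} (hz : z ∈ V)
    (X Y Z W : E) :
    localCurvature A z X Y Z W =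
      localCurvature A' (τ z) (J z X) (J z Y) (J z Z) (J z W) := by
  have hz' := hτ.mapsTo hz
  rw [← hA.inner_wirtingerBar hΓ (hVU hz), ← hA'.inner_wirtingerBar hΓ' hz',
    hτ.isometry z hz, map_neg]
  congr 3
  have hC : HasFDerivAt (fun ζ => chernCLM A ζ X Z)
      (((fderiv ℝ (chernCLM A) z).flip X).flip Z) z := by
    have h1 := ((hA.contDiffOn_chernCLM.contDiffAt (hA.isOpen.mem_nhds
      (hVU hz))).differentiableAt (by simp)).hasFDerivAt
    refine ((h1.clm_apply (hasFDerivAt_const X z)).clm_apply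
      (hasFDerivAt_const Z z)).congr_fderiv ?_
    ext v
    simp
  have hC' : HasFDerivAt (chernCLM A') (fderiv ℝ (chernCLM A') (τ z)) (τ z) :=
    ((hA'.contDiffOn_chernCLM.contDiffAt (hA'.isOpen.mem_nhds hz')).differentiableAt
      (by simp)).hasFDerivAt
  have hCc : HasFDerivAt (fun ζ => chernCLM A' ζ (J z X) (J z Z))
      (((fderiv ℝ (chernCLM A') (τ z)).flip (J z X)).flip (J z Z)) (τ z) := by
    refine ((hC'.clm_apply (hasFDerivAt_const _ _)).clm_apply
      (hasFDerivAt_const _ _)).congr_fderiv ?_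
    ext v
    simp
  have h1 : wirtingerBar (fun ζ => Γ ζ X Z) z Y = wirtingerBar (fun ζ => chernCLM A ζ X Z) z Y :=
    Filter.EventuallyEq.wirtingerBar_eq (Filter.eventually_of_mem (hA.isOpen.mem_nhds (hVU hz))
      fun ζ hζ => (hA.chernCLM_eq hΓ hζ X Z).symm) Y
  have h2 : wirtingerBar (fun ζ => Γ' ζ (J z X) (J z Z)) (τ z) (J z Y) =
      wirtingerBar (fun ζ => chernCLM A' ζ (J z X) (J z Z)) (τ z) (J z Y) :=
    Filter.EventuallyEq.wirtingerBar_eq (Filter.eventually_of_mem (hA'.isOpen.mem_nhds hz')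
      fun ζ hζ => (hA'.chernCLM_eq hΓ' hζ _ _).symm) _
  rw [h1, h2, hC.wirtingerBar_eq, hCc.wirtingerBar_eq]
  obtain ⟨L, hL, hLv⟩ := hτ.exists_hasFDerivAt_apply hz hC
  have hR := (((hC'.comp z (hτ.hasFDerivAt_real hz)).clm_apply
    (hτ.hasFDerivAt_apply_const hz X)).clm_apply (hτ.hasFDerivAt_apply_const hz Z)).add
    (hτ.hasFDerivAt_fderiv_apply_const hz X Z)
  have heq : (fun ζ => J ζ (chernCLM A ζ X Z)) =ᶠ[nhds z] fun ζ =>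
      chernCLM A' (τ ζ) (J ζ X) (J ζ Z) + fderiv ℂ J ζ X Z := by
    refine Filter.eventually_of_mem (hτ.isOpen.mem_nhds hz) fun ζ hζ => ?_
    change J ζ (chernCLM A ζ X Z) = _
    rw [hA.chernCLM_eq hΓ (hVU hζ), hτ.map_connection hA' hVU hΓ hΓ' hζ]
    change _ = chernCLM A' (τ ζ) (J ζ X) (J ζ Z) + _
    rw [hA'.chernCLM_eq hΓ' (hτ.mapsTo hζ)]
  have h3 := hL.unique (HasFDerivAt.congr_of_eventuallyEq hR heq)
  have h4 : ∀ v, J z ((((fderiv ℝ (chernCLM A) z).flip X).flip Z) v) =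
      fderiv ℝ (chernCLM A') (τ z) (J z v) (J z X) (J z Z) +
      chernCLM A' (τ z) (fderiv ℂ J z v X) (J z Z) +
      chernCLM A' (τ z) (J z X) (fderiv ℂ J z v Z) +
      fderiv ℂ (fderiv ℂ J) z v X Z - fderiv ℂ J z v (chernCLM A z X Z) := by
    intro v
    have h5 := DFunLike.congr_fun h3 v
    rw [hLv] at h5
    rw [eq_sub_iff_add_eq, add_comm, h5]
    simp only [add_apply, ContinuousLinearMap.comp_apply, ContinuousLinearMap.flip_apply,
      ContinuousLinearMap.coe_restrictScalars', Function.comp_apply]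
    abel
  rw [map_smul, map_add, map_smul, h4, h4]
  simp only [map_smul, smul_apply, hA'.chernCLM_I_smul_left hΓ' hz',
    hA'.chernCLM_I_smul_right hΓ' hz', ContinuousLinearMap.flip_apply, smul_add, smul_sub,
    smul_smul, Complex.I_mul_I]
  module

end IsHolomorphicIsometry

end LocalMetricTransition

/-! ### The curvature tensor of the manifold in charts -/

theorem wirtingerBar_add_vec {E F : Type*} [NormedAddCommGroup E] [NormedSpace ℂ E]
    [NormedAddCommGroup F] [NormedSpace ℂ F] (f : E → F) (z v w : E) :
    wirtingerBar f z (v + w) = wirtingerBar f z v + wirtingerBar f z w := by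
  simp only [wirtingerBar, smul_add, map_add]
  abel

theorem wirtingerBar_smul_vec {E F : Type*} [NormedAddCommGroup E] [NormedSpace ℂ E]
    [NormedAddCommGroup F] [NormedSpace ℂ F] (f : E → F) (z : E) (a : ℂ) (v : E) :
    wirtingerBar f z (a • v) = conj a • wirtingerBar f z v := by
  have h1 : a • v = a.re • v + a.im • (Complex.I • v) := by
    rw [← Complex.coe_smul a.re, ← Complex.coe_smul a.im, smul_smul, ← add_smul,
      Complex.re_add_im]
  have h2 : Complex.I • a • v = a.re • (Complex.I • v) - a.im • v := by
    rw [← Complex.coe_smul a.re, ← Complex.coe_smul a.im, smul_smul, smul_smul, ← sub_smul]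
    congr 1
    apply Complex.ext <;> simp
  have h3 : conj a = (a.re : ℂ) - a.im * Complex.I := by
    apply Complex.ext <;> simp
  rw [wirtingerBar, wirtingerBar, h2, h1, map_add, map_sub, (fderiv ℝ f z).map_smul,
    (fderiv ℝ f z).map_smul, (fderiv ℝ f z).map_smul, (fderiv ℝ f z).map_smul, h3]
  set p := fderiv ℝ f z v
  set q := fderiv ℝ f z (Complex.I • v)
  simp only [← Complex.coe_smul a.re, ← Complex.coe_smul a.im]
  match_scalars
  · ring
  · linear_combination (1 / 2 : ℂ) * a.im * Complex.I_sq

namespace HermitianMetric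

variable {E : Type*} [NormedAddCommGroup E] [NormedSpace ℂ E]
  {M : Type*} [TopologicalSpace M] [ChartedSpace E M] [IsManifold 𝓘(ℂ, E) ω M]

variable (h : HermitianMetric E M)

theorem coord_extChartAt {c x : M} (hx : x ∈ (extChartAt 𝓘(ℂ, E) c).source) (v w : E) :
    h.coord c (extChartAt 𝓘(ℂ, E) c x) v w =
      h.inner x (tangentCoordChange 𝓘(ℂ, E) c x x v) (tangentCoordChange 𝓘(ℂ, E) c x x w) := by
  -- The tangent space depends on the point, so the identity of points is substituted in the whole
  -- expression at once.
  have h1 : ∀ y, y = x → h.inner y (tangentCoordChange 𝓘(ℂ, E) c y y v)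
      (tangentCoordChange 𝓘(ℂ, E) c y y w) =
      h.inner x (tangentCoordChange 𝓘(ℂ, E) c x x v) (tangentCoordChange 𝓘(ℂ, E) c x x w) := by
    rintro y rfl
    rfl
  exact h1 _ ((extChartAt 𝓘(ℂ, E) c).left_inv hx)

theorem coord_extChartAt_self (x : M) (v w : E) :
    h.coord x (extChartAt 𝓘(ℂ, E) x x) v w = h.inner x v w := by
  rw [coord_extChartAt h (mem_extChartAt_source x)]
  rw [tangentCoordChange_self (mem_extChartAt_source x),
    tangentCoordChange_self (mem_extChartAt_source x)]

theorem tangentCoordChange_leftInverse {c x y : M} (hc : y ∈ (extChartAt 𝓘(ℂ, E) c).source)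
    (hx : y ∈ (extChartAt 𝓘(ℂ, E) x).source) (v : E) :
    tangentCoordChange 𝓘(ℂ, E) x c y (tangentCoordChange 𝓘(ℂ, E) c x y v) = v := by
  rw [tangentCoordChange_comp ⟨⟨hc, hx⟩, hc⟩, tangentCoordChange_self hc]

/-- The metric in the chart around `c` as a continuous real bilinear map. -/
noncomputable def coordCLM [FiniteDimensional ℂ E] (c : M) (z : E) :
    E →L[ℝ] E →L[ℝ] ℂ :=
  haveI : FiniteDimensional ℝ E := FiniteDimensional.complexToReal E
  bilinCLM (h.coord c z)

variable [FiniteDimensional ℂ E]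

theorem coordCLM_apply (c : M) (z v w : E) : h.coordCLM c z v w = h.coord c z v w := by
  have : FiniteDimensional ℝ E := FiniteDimensional.complexToReal E
  let B : E →ₗ[ℝ] E →ₗ[ℝ] ℂ := LinearMap.mk₂ ℝ (h.coord c z)
    (fun _ _ _ => by simp only [coord, map_add, LinearMap.add_apply])
    (fun a v w => by
      simp only [coord]
      rw [← Complex.coe_smul a v, map_smul, map_smul, LinearMap.smul_apply, Complex.coe_smul])
    (fun _ _ _ => by simp only [coord, map_add])
    (fun a v w => by
      simp only [coord]
      rw [← Complex.coe_smul a w, map_smul, LinearMap.map_smulₛₗ, Complex.conj_ofReal,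
        Complex.coe_smul])
  exact bilinCLM_apply B v w

theorem isLocalMetric_coordCLM (c : M) :
    IsLocalMetric (h.coordCLM c) (extChartAt 𝓘(ℂ, E) c).target where
  isOpen := isOpen_extChartAt_target c
  smooth := contDiffOn_bilinCLM fun v w => h.smooth c v w
  smul_left z a v w := by
    simp only [coordCLM_apply, coord, map_smul, LinearMap.smul_apply, smul_eq_mul]
  conj_symm z v w := by
    simp only [coordCLM_apply, coord, h.conj_symm]
  pos z hz v hv := by
    rw [coordCLM_apply, ← (extChartAt 𝓘(ℂ, E) c).right_inv hz,
      h.coord_extChartAt ((extChartAt 𝓘(ℂ, E) c).map_target hz)]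
    refine h.pos _ _ fun h0 => hv ?_
    rw [← tangentCoordChange_leftInverse ((extChartAt 𝓘(ℂ, E) c).map_target hz)
      (mem_extChartAt_source _) v]
    exact (congrArg _ h0).trans (map_zero _)

theorem isChernConnection_christoffel (c : M) :
    IsChernConnection (h.coordCLM c) (extChartAt 𝓘(ℂ, E) c).target (h.christoffel c) := by
  intro z hz X Z W
  simp only [coordCLM_apply]
  exact Classical.epsilon_spec (h.existsUnique_christoffel c hz X Z).exists W

theorem isHolomorphicIsometry_coordChange (c x : M) :
    IsHolomorphicIsometry (h.coordCLM c) (h.coordCLM x)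
      ((extChartAt 𝓘(ℂ, E) c).symm ≫ extChartAt 𝓘(ℂ, E) x).source
      (extChartAt 𝓘(ℂ, E) x).target
      (extChartAt 𝓘(ℂ, E) x ∘ (extChartAt 𝓘(ℂ, E) c).symm)
      (fun ζ => tangentCoordChange 𝓘(ℂ, E) c x ((extChartAt 𝓘(ℂ, E) c).symm ζ)) := by
  have hopen : IsOpen ((extChartAt 𝓘(ℂ, E) c).symm ≫ extChartAt 𝓘(ℂ, E) x).source := by
    rw [PartialEquiv.trans_source]
    exact (continuousOn_extChartAt_symm c).isOpen_inter_preimage (isOpen_extChartAt_target c)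
      (isOpen_extChartAt_source x)
  have hmem : ∀ ζ ∈ ((extChartAt 𝓘(ℂ, E) c).symm ≫ extChartAt 𝓘(ℂ, E) x).source,
      ζ ∈ (extChartAt 𝓘(ℂ, E) c).target ∧
      (extChartAt 𝓘(ℂ, E) c).symm ζ ∈ (extChartAt 𝓘(ℂ, E) c).source ∧
      (extChartAt 𝓘(ℂ, E) c).symm ζ ∈ (extChartAt 𝓘(ℂ, E) x).source := fun ζ hζ =>
    ⟨hζ.1, (extChartAt 𝓘(ℂ, E) c).map_target hζ.1, hζ.2⟩
  have hderiv : ∀ ζ ∈ ((extChartAt 𝓘(ℂ, E) c).symm ≫ extChartAt 𝓘(ℂ, E) x).source,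
      HasFDerivAt (extChartAt 𝓘(ℂ, E) x ∘ (extChartAt 𝓘(ℂ, E) c).symm)
        (tangentCoordChange 𝓘(ℂ, E) c x ((extChartAt 𝓘(ℂ, E) c).symm ζ)) ζ := by
    intro ζ hζ
    obtain ⟨h1, h2, h3⟩ := hmem ζ hζ
    have h4 := hasFDerivWithinAt_tangentCoordChange (I := 𝓘(ℂ, E)) ⟨h2, h3⟩
    rw [(extChartAt 𝓘(ℂ, E) c).right_inv h1] at h4
    simpa using h4
  refine ⟨hopen, fun ζ hζ => (extChartAt 𝓘(ℂ, E) x).map_source (hmem ζ hζ).2.2, hderiv, ?_, ?_, ?_⟩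
  · have h1 : ContDiffOn ℂ ω (extChartAt 𝓘(ℂ, E) x ∘ (extChartAt 𝓘(ℂ, E) c).symm)
        ((extChartAt 𝓘(ℂ, E) c).symm ≫ extChartAt 𝓘(ℂ, E) x).source :=
      contDiffOn_ext_coord_change x c
    have h2 := h1.fderiv_of_isOpen (m := ∞) hopen (by simp)
    exact h2.congr fun ζ hζ => (hderiv ζ hζ).fderiv.symm
  · intro ζ hζ v w
    obtain ⟨h1, h2, h3⟩ := hmem ζ hζ
    rw [coordCLM_apply, coordCLM_apply, Function.comp_apply, h.coord_extChartAt h3]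
    rw [tangentCoordChange_comp ⟨⟨h2, h3⟩, mem_extChartAt_source _⟩,
      tangentCoordChange_comp ⟨⟨h2, h3⟩, mem_extChartAt_source _⟩]
    rfl
  · intro ζ hζ u
    obtain ⟨h1, h2, h3⟩ := hmem ζ hζ
    exact ⟨_, tangentCoordChange_leftInverse h3 h2 u⟩

theorem curvature_eq_localCurvature_self (x : M) (X Y Z W : E) :
    h.curvature x X Y Z W =
      localCurvature (h.coordCLM x) (extChartAt 𝓘(ℂ, E) x x) X Y Z W := by
  rw [← (h.isLocalMetric_coordCLM x).inner_wirtingerBar (h.isChernConnection_christoffel x)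
    (mem_extChartAt_target x), coordCLM_apply, coord_extChartAt_self]
  rfl

/-- The curvature tensor may be computed in any chart. -/
theorem curvature_tangentCoordChange {c x : M} (hx : x ∈ (extChartAt 𝓘(ℂ, E) c).source)
    (X Y Z W : E) :
    h.curvature x (tangentCoordChange 𝓘(ℂ, E) c x x X) (tangentCoordChange 𝓘(ℂ, E) c x x Y)
      (tangentCoordChange 𝓘(ℂ, E) c x x Z) (tangentCoordChange 𝓘(ℂ, E) c x x W) =
      localCurvature (h.coordCLM c) (extChartAt 𝓘(ℂ, E) c x) X Y Z W := by
  have hz : extChartAt 𝓘(ℂ, E) c x ∈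
      ((extChartAt 𝓘(ℂ, E) c).symm ≫ extChartAt 𝓘(ℂ, E) x).source := by
    refine ⟨(extChartAt 𝓘(ℂ, E) c).map_source hx, ?_⟩
    change (extChartAt 𝓘(ℂ, E) c).symm (extChartAt 𝓘(ℂ, E) c x) ∈ (extChartAt 𝓘(ℂ, E) x).source
    rw [(extChartAt 𝓘(ℂ, E) c).left_inv hx]
    exact mem_extChartAt_source x
  rw [(h.isHolomorphicIsometry_coordChange c x).localCurvature_eq (h.isLocalMetric_coordCLM c)
    (h.isLocalMetric_coordCLM x) (fun ζ hζ => hζ.1) (h.isChernConnection_christoffel c)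
    (h.isChernConnection_christoffel x) hz, curvature_eq_localCurvature_self, Function.comp_apply,
    (extChartAt 𝓘(ℂ, E) c).left_inv hx]

/-- The definition shows conjugate linearity in the second slot, through ∂̄. Hermitian symmetry
carries it over to linearity in the first. -/
theorem isKahlerCurvatureTensor (hCKL : h.IsChernKahlerLike) (x : M) :
    IsKahlerCurvatureTensor (h.curvature x) := by
  have hconj : ∀ X Y Z W, conj (h.curvature x X Y Z W) = h.curvature x Y X W Z := fun X Y Z W => by
    refine (congrArg _ (h.curvature_eq_localCurvature_self x X Y Z W)).trans
      (Eq.trans ?_ (h.curvature_eq_localCurvature_self x Y X W Z).symm)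
    exact (h.isLocalMetric_coordCLM x).localCurvature_conj (mem_extChartAt_target x) X Y Z W
  have hadd : ∀ X Y Y' Z W, h.curvature x X (Y + Y') Z W =
      h.curvature x X Y Z W + h.curvature x X Y' Z W := fun X Y Y' Z W => by
    have h1 : h.curvatureOp x X (Y + Y') Z = h.curvatureOp x X Y Z + h.curvatureOp x X Y' Z := by
      have h2 := wirtingerBar_add_vec (E := E) (F := E) (fun z : E => h.christoffel x z X Z)
        (extChartAt 𝓘(ℂ, E) x x) Y Y'
      exact (congrArg Neg.neg h2).trans (neg_add _ _)
    rw [curvature, h1, map_add]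
    rfl
  have hsmul : ∀ (a : ℂ) X Y Z W, h.curvature x X (a • Y) Z W =
      conj a * h.curvature x X Y Z W := fun a X Y Z W => by
    have h1 : h.curvatureOp x X (a • Y) Z = conj a • h.curvatureOp x X Y Z := by
      have h2 := wirtingerBar_smul_vec (E := E) (F := E) (fun z : E => h.christoffel x z X Z)
        (extChartAt 𝓘(ℂ, E) x x) a Y
      exact (congrArg Neg.neg h2).trans (smul_neg _ _).symm
    rw [curvature, h1, map_smul]
    rfl
  refine ⟨fun X X' Y Z W => ?_, fun a X Y Z W => ?_, hCKL x, hconj⟩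
  · rw [← hconj, hadd, map_add, hconj, hconj]
  · rw [← hconj, hsmul, map_mul, hconj, Complex.conj_conj]

end HermitianMetric

/-! ### Compactness of unitary frames and attained extrema -/

namespace HermitianMetric

variable {E : Type*} [NormedAddCommGroup E] [NormedSpace ℂ E]
  {M : Type*} [TopologicalSpace M] [ChartedSpace E M] [IsManifold 𝓘(ℂ, E) ω M]
  (h : HermitianMetric E M)

theorem normSq_nonneg (x : M) (v : TangentSpace 𝓘(ℂ, E) x) : 0 ≤ h.normSq x v := by
  by_cases hv : v = 0
  · simp [normSq, hv]
  · exact (h.pos x v hv).le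

theorem normSq_sum_smul {x : M} {k : ℕ} {e : Fin k → TangentSpace 𝓘(ℂ, E) x}
    (he : IsUnitaryFrame (h.inner x) e) (a : EuclideanSpace ℂ (Fin k)) :
    h.normSq x (∑ j, a j • e j) = ‖a‖ ^ 2 := by
  have h1 : h.inner x (∑ j, a j • e j) (∑ j, a j • e j) = ∑ j, a j * conj (a j) := by
    simp [he _ _, mul_comm]
  rw [normSq, h1, EuclideanSpace.norm_sq_eq, Complex.re_sum]
  refine Finset.sum_congr rfl fun j _ => ?_
  rw [Complex.mul_conj, Complex.ofReal_re, Complex.normSq_eq_norm_sq]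

theorem normSq_smul (x : M) (s : ℝ) (X : TangentSpace 𝓘(ℂ, E) x) :
    h.normSq x ((s : ℂ) • X) = s ^ 2 * h.normSq x X := by
  simp only [normSq, map_smul, LinearMap.smul_apply, LinearMap.map_smulₛₗ, Complex.conj_ofReal,
    smul_eq_mul, Complex.re_ofReal_mul]
  ring

/-- The set of the pairs of a point of `K` and a unitary `k`-frame at this point, in the chart
around `c`. -/
def unitaryFrames (c : M) (K : Set E) (k : ℕ) : Set (E × (Fin k → E)) :=
  {p | p.1 ∈ K ∧ ∀ i j, h.coord c p.1 (p.2 i) (p.2 j) = if i = j then 1 else 0}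

theorem isUnitaryFrame_tangentCoordChange_iff {c x : M}
    (hx : x ∈ (extChartAt 𝓘(ℂ, E) c).source) {K : Set E} (hxK : extChartAt 𝓘(ℂ, E) c x ∈ K)
    {k : ℕ} (e : Fin k → E) :
    IsUnitaryFrame (h.inner x) (fun i => (tangentCoordChange 𝓘(ℂ, E) c x x (e i) :
      TangentSpace 𝓘(ℂ, E) x)) ↔ (extChartAt 𝓘(ℂ, E) c x, e) ∈ h.unitaryFrames c K k := by
  simp only [unitaryFrames, Set.mem_ofPred_eq, hxK, true_and, h.coord_extChartAt hx]
  rfl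

theorem exists_unit_smul {x : M} {X : TangentSpace 𝓘(ℂ, E) x} (hX : X ≠ 0) :
    ∃ (s : ℝ), 0 < s ∧ s ^ 2 * h.normSq x X = 1 := by
  have h1 : 0 < h.normSq x X := h.pos x X hX
  refine ⟨(Real.sqrt (h.normSq x X))⁻¹, by positivity, ?_⟩
  rw [inv_pow, Real.sq_sqrt h1.le, inv_mul_cancel₀ h1.ne']

variable [FiniteDimensional ℂ E]

section Frames

variable {x : M} {k : ℕ} {S : Submodule ℂ (TangentSpace 𝓘(ℂ, E) x)}
  {e : Fin k → TangentSpace 𝓘(ℂ, E) x}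

theorem exists_unitaryFrame_span_eq (hS : Module.finrank ℂ S = k) :
    ∃ e : Fin k → TangentSpace 𝓘(ℂ, E) x, IsUnitaryFrame (h.inner x) e ∧
      Submodule.span ℂ (Set.range e) = S := by
  subst hS
  exact h.exists_isUnitaryBasis x S

theorem exists_unitaryFrame (x : M) (hk : k ≤ Module.finrank ℂ E) :
    ∃ e : Fin k → TangentSpace 𝓘(ℂ, E) x, IsUnitaryFrame (h.inner x) e := by
  obtain ⟨e, he, -⟩ := h.exists_isUnitaryBasis x ⊤
  have hfin : Module.finrank ℂ (⊤ : Submodule ℂ (TangentSpace 𝓘(ℂ, E) x)) = Module.finrank ℂ E :=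
    finrank_top ℂ (TangentSpace 𝓘(ℂ, E) x)
  refine ⟨fun i => e (Fin.castLE (hk.trans hfin.ge) i), fun i j => ?_⟩
  rw [he]
  simp

theorem planeCurvature_eq (hR : IsKahlerCurvatureTensor (h.curvature x))
    (he : IsUnitaryFrame (h.inner x) e) (hS : Submodule.span ℂ (Set.range e) = S)
    (u : TangentSpace 𝓘(ℂ, E) x) :
    h.planeCurvature x S u = (∑ i, h.curvature x (e i) (e i) u u).re := by
  obtain ⟨h1, h2⟩ := (h.exists_isUnitaryBasis x S).choose_spec
  exact congrArg Complex.re (hR.sum_frame_left (h.conj_symm x) h1 he (h2.trans hS.symm) u u)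

theorem kRicci_eq (hR : IsKahlerCurvatureTensor (h.curvature x))
    (he : IsUnitaryFrame (h.inner x) e) (hS : Submodule.span ℂ (Set.range e) = S)
    (u : TangentSpace 𝓘(ℂ, E) x) :
    h.kRicci x S u = (∑ i, h.curvature x u u (e i) (e i)).re := by
  obtain ⟨h1, h2⟩ := (h.exists_isUnitaryBasis x S).choose_spec
  exact congrArg Complex.re (hR.sum_frame_right (h.conj_symm x) h1 he (h2.trans hS.symm) u u)

theorem kScalar_eq (hR : IsKahlerCurvatureTensor (h.curvature x))
    (he : IsUnitaryFrame (h.inner x) e) (hS : Submodule.span ℂ (Set.range e) = S) :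
    h.kScalar x S = (∑ i, ∑ j, h.curvature x (e i) (e i) (e j) (e j)).re := by
  obtain ⟨h1, h2⟩ := (h.exists_isUnitaryBasis x S).choose_spec
  exact congrArg Complex.re (hR.sum_sum_frame (h.conj_symm x) h1 he (h2.trans hS.symm))

theorem kRicci_smul (hR : IsKahlerCurvatureTensor (h.curvature x))
    (S : Submodule ℂ (TangentSpace 𝓘(ℂ, E) x)) (s : ℝ) (X : TangentSpace 𝓘(ℂ, E) x) :
    h.kRicci x S ((s : ℂ) • X) = s ^ 2 * h.kRicci x S X := by
  simp only [kRicci, hR.smul_left, hR.smul₂, Complex.conj_ofReal, ← Finset.mul_sum,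
    Complex.re_ofReal_mul]
  ring

end Frames

/-- By compactness of K times the unit sphere the metric has a positive lower bound there;
homogeneity does the rest. This keeps unitary frames over K bounded. -/
theorem exists_mul_norm_sq_le {c : M} {K : Set E} (hK : IsCompact K)
    (hKc : K ⊆ (extChartAt 𝓘(ℂ, E) c).target) :
    ∃ r : ℝ, 0 < r ∧ ∀ z ∈ K, ∀ v, r * ‖v‖ ^ 2 ≤ (h.coord c z v v).re := by
  have : ProperSpace E := FiniteDimensional.proper ℂ E
  have hA := h.isLocalMetric_coordCLM c
  have hcont : ContinuousOn (fun p : E × E => (h.coordCLM c p.1 p.2 p.2).re)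
      (K ×ˢ Metric.sphere 0 1) := by
    have h1 : ContinuousOn (fun p : E × E => h.coordCLM c p.1) (K ×ˢ Metric.sphere 0 1) :=
      hA.smooth.continuousOn.comp continuousOn_fst fun p hp => hKc hp.1
    exact Complex.continuous_re.comp_continuousOn
      ((h1.clm_apply continuousOn_snd).clm_apply continuousOn_snd)
  obtain ⟨r, hr, hr'⟩ := (hK.prod (isCompact_sphere 0 1)).exists_forall_le' hcont
    (a := 0) fun p hp => hA.pos p.1 (hKc hp.1) p.2 fun h0 => by
      have h1 := hp.2
      rw [h0] at h1
      simp at h1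
  refine ⟨r, hr, fun z hz v => ?_⟩
  by_cases hv : v = 0
  · rw [hv, ← coordCLM_apply]
    simp
  have hv' : ‖v‖ ≠ 0 := norm_ne_zero_iff.2 hv
  have h1 := hr' (z, ((‖v‖⁻¹ : ℝ) : ℂ) • v) ⟨hz, by
    simp [norm_smul, hv']⟩
  simp only [hA.smul_left, hA.smul_right, Complex.conj_ofReal, Complex.re_ofReal_mul,
    coordCLM_apply] at h1
  have h2 := mul_le_mul_of_nonneg_right h1 (sq_nonneg ‖v‖)
  refine h2.trans_eq ?_
  field_simp

theorem isCompact_unitaryFrames {c : M} {K : Set E} (hK : IsCompact K)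
    (hKc : K ⊆ (extChartAt 𝓘(ℂ, E) c).target) (k : ℕ) : IsCompact (h.unitaryFrames c K k) := by
  have : ProperSpace E := FiniteDimensional.proper ℂ E
  have hA := h.isLocalMetric_coordCLM c
  obtain ⟨r, hr, hrK⟩ := h.exists_mul_norm_sq_le hK hKc
  -- A unitary vector v has ‖v‖² ≤ 1/r, hence ‖v‖ ≤ ‖v‖² + 1 ≤ 1/r + 1.
  set s : Set (E × (Fin k → E)) := K ×ˢ Metric.closedBall 0 (1 / r + 1) with hs
  have hsc : IsCompact s := hK.prod (isCompact_closedBall _ _)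
  have hcont : ContinuousOn (fun (p : E × (Fin k → E)) (i j : Fin k) =>
      h.coordCLM c p.1 (p.2 i) (p.2 j)) s := by
    have h1 : ContinuousOn (fun p : E × (Fin k → E) => h.coordCLM c p.1) s :=
      hA.smooth.continuousOn.comp continuousOn_fst fun p hp => hKc hp.1
    refine continuousOn_pi.2 fun i => continuousOn_pi.2 fun j => ?_
    exact (h1.clm_apply (by fun_prop)).clm_apply (by fun_prop)
  have hclosed := hcont.preimage_isClosed_of_isClosed hsc.isClosed
    (isClosed_singleton (x := fun i j : Fin k => if i = j then (1 : ℂ) else 0))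
  have heq : h.unitaryFrames c K k = s ∩ (fun (p : E × (Fin k → E)) (i j : Fin k) =>
      h.coordCLM c p.1 (p.2 i) (p.2 j)) ⁻¹' {fun i j : Fin k => if i = j then (1 : ℂ) else 0} := by
    ext p
    simp only [unitaryFrames, Set.mem_ofPred_eq, Set.mem_inter_iff, Set.mem_preimage,
      Set.mem_singleton_iff, funext_iff, coordCLM_apply, hs, Set.mem_prod]
    constructor
    · rintro ⟨h1, h2⟩
      refine ⟨⟨h1, ?_⟩, h2⟩
      rw [mem_closedBall_zero_iff, pi_norm_le_iff_of_nonneg (by positivity)]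
      intro i
      have h3 := hrK p.1 h1 (p.2 i)
      rw [h2, if_pos rfl, Complex.one_re] at h3
      have h4 : ‖p.2 i‖ ^ 2 ≤ 1 / r := by
        rw [le_div_iff₀ hr]
        linarith
      nlinarith [sq_nonneg (‖p.2 i‖ - 1), norm_nonneg (p.2 i)]
    · rintro ⟨⟨h1, -⟩, h2⟩
      exact ⟨h1, h2⟩
  rw [heq]
  exact hsc.of_isClosed_subset hclosed Set.inter_subset_left

/-- Replaces planes and unit vectors in them by frames and coefficients on a unit sphere, a
parametrization to which compactness applies. -/
theorem mem_unitKRicciValues_iff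
    (hR : ∀ x, IsKahlerCurvatureTensor (h.curvature x)) {k : ℕ} {r : ℝ} :
    r ∈ h.unitKRicciValues k ↔ ∃ (x : M) (e : Fin k → TangentSpace 𝓘(ℂ, E) x)
      (a : EuclideanSpace ℂ (Fin k)), IsUnitaryFrame (h.inner x) e ∧ ‖a‖ = 1 ∧
      r = (∑ i, h.curvature x (∑ j, a j • e j) (∑ j, a j • e j) (e i) (e i)).re := by
  constructor
  · rintro ⟨x, S, X, hS, hX, hn, rfl⟩
    obtain ⟨e, he, hspan⟩ := h.exists_unitaryFrame_span_eq hS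
    have h1 := he.sum_smul_eq (hspan ▸ hX)
    refine ⟨x, e, WithLp.toLp 2 fun j => h.inner x X (e j), he, ?_, ?_⟩
    · have h2 := h.normSq_sum_smul he (WithLp.toLp 2 fun j => h.inner x X (e j))
      simp only [h1, hn] at h2
      exact (pow_eq_one_iff_of_nonneg (norm_nonneg _) two_ne_zero).1 h2.symm
    · simp only [h1]
      exact h.kRicci_eq (hR x) he hspan X
  · rintro ⟨x, e, a, he, ha, rfl⟩
    refine ⟨x, Submodule.span ℂ (Set.range e), ∑ j, a j • e j, he.finrank_span,
      Submodule.sum_mem _ fun j _ => Submodule.smul_mem _ _ (Submodule.subset_span ⟨j, rfl⟩), ?_,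
      (h.kRicci_eq (hR x) he rfl _).symm⟩
    rw [h.normSq_sum_smul he, ha, one_pow]

/-- M is covered by finitely many preimages of closed balls in charts. Over each ball the values are
a continuous image of unitary frames times the unit sphere of ℂᵏ, because the curvature may be
computed in that fixed chart. -/
theorem isCompact_unitKRicciValues [CompactSpace M]
    (hR : ∀ x, IsKahlerCurvatureTensor (h.curvature x)) (k : ℕ) :
    IsCompact (h.unitKRicciValues k) := by
  have : ProperSpace E := FiniteDimensional.proper ℂ E
  have hnhds : ∀ c : M, ∃ r > 0, Metric.closedBall (extChartAt 𝓘(ℂ, E) c c) r ⊆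
      (extChartAt 𝓘(ℂ, E) c).target := fun c =>
    Metric.nhds_basis_closedBall.mem_iff.1 (extChartAt_target_mem_nhds (I := 𝓘(ℂ, E)) c)
  choose r hr hrt using hnhds
  set K : M → Set E := fun c => Metric.closedBall (extChartAt 𝓘(ℂ, E) c c) (r c) with hKdef
  obtain ⟨t, ht⟩ := CompactSpace.elim_nhds_subcover
    (fun c : M => (extChartAt 𝓘(ℂ, E) c).source ∩ extChartAt 𝓘(ℂ, E) c ⁻¹' K c) fun c =>
      Filter.inter_mem (extChartAt_source_mem_nhds c)
        ((continuousAt_extChartAt c).preimage_mem_nhds (Metric.closedBall_mem_nhds _ (hr c)))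
  set F : M → (E × (Fin k → E)) × EuclideanSpace ℂ (Fin k) → ℝ := fun c p =>
    (∑ i, localCurvature (h.coordCLM c) p.1.1 (∑ j, p.2 j • p.1.2 j) (∑ j, p.2 j • p.1.2 j)
      (p.1.2 i) (p.1.2 i)).re with hF
  have hFvalue : ∀ (c x : M) (hx : x ∈ (extChartAt 𝓘(ℂ, E) c).source) (e : Fin k → E)
      (a : EuclideanSpace ℂ (Fin k)), F c ((extChartAt 𝓘(ℂ, E) c x, e), a) =
      (∑ i, h.curvature x (∑ j, a j • (tangentCoordChange 𝓘(ℂ, E) c x x (e j)))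
        (∑ j, a j • (tangentCoordChange 𝓘(ℂ, E) c x x (e j)))
        (tangentCoordChange 𝓘(ℂ, E) c x x (e i)) (tangentCoordChange 𝓘(ℂ, E) c x x (e i))).re := by
    intro c x hx e a
    have h1 : ∀ Y : TangentSpace 𝓘(ℂ, E) x,
        Y = tangentCoordChange 𝓘(ℂ, E) c x x (∑ j, a j • e j) →
        F c ((extChartAt 𝓘(ℂ, E) c x, e), a) =
          (∑ i, h.curvature x Y Y (tangentCoordChange 𝓘(ℂ, E) c x x (e i))
            (tangentCoordChange 𝓘(ℂ, E) c x x (e i))).re := by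
      rintro _ rfl
      simp only [hF, ← h.curvature_tangentCoordChange hx]
    have h2 : ∑ j, a j • (tangentCoordChange 𝓘(ℂ, E) c x x (e j)) =
        tangentCoordChange 𝓘(ℂ, E) c x x (∑ j, a j • e j) := by
      simp only [map_sum, map_smul]
    exact h1 _ h2

  have hcompact : ∀ c, IsCompact
      (F c '' (h.unitaryFrames c (K c) k ×ˢ Metric.sphere (0 : EuclideanSpace ℂ (Fin k)) 1)) := by
    intro c
    refine ((h.isCompact_unitaryFrames (isCompact_closedBall _ _) (hrt c) k).prod
      (isCompact_sphere _ _)).image_of_continuousOn ?_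
    refine Complex.continuous_re.comp_continuousOn (continuousOn_finsetSum _ fun i _ => ?_)
    refine (h.isLocalMetric_coordCLM c).continuousOn_localCurvature (by fun_prop)
      (fun p hp => hrt c hp.1.1) ?_ ?_ (by fun_prop) (by fun_prop) <;>
    exact continuousOn_finsetSum _ fun j _ => ContinuousOn.smul (by fun_prop) (by fun_prop)
  have heq : h.unitKRicciValues k = ⋃ c ∈ t,
      F c '' (h.unitaryFrames c (K c) k ×ˢ Metric.sphere (0 : EuclideanSpace ℂ (Fin k)) 1) := by
    ext s
    rw [h.mem_unitKRicciValues_iff hR]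
    simp only [Set.mem_iUnion]
    constructor
    · rintro ⟨x, e, a, he, ha, rfl⟩
      have hxt : x ∈ ⋃ c ∈ t, (extChartAt 𝓘(ℂ, E) c).source ∩ extChartAt 𝓘(ℂ, E) c ⁻¹' K c := by
        rw [ht]; trivial
      simp only [Set.mem_iUnion] at hxt
      obtain ⟨c, hc, hx, hxK⟩ := hxt
      obtain ⟨e', rfl⟩ : ∃ e' : Fin k → E, e = fun i =>
          (tangentCoordChange 𝓘(ℂ, E) c x x (e' i) : TangentSpace 𝓘(ℂ, E) x) :=
        ⟨fun i => tangentCoordChange 𝓘(ℂ, E) x c x (e i), funext fun i =>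
          (tangentCoordChange_leftInverse (mem_extChartAt_source x) hx (e i)).symm⟩
      exact ⟨c, hc, ((extChartAt 𝓘(ℂ, E) c x, e'), a),
        ⟨(h.isUnitaryFrame_tangentCoordChange_iff hx hxK e').1 he, by simpa using ha⟩,
        hFvalue c x hx e' a⟩
    · rintro ⟨c, hc, ⟨⟨z, e⟩, a⟩, ⟨⟨hz, he⟩, ha⟩, rfl⟩
      have hzt := hrt c hz
      obtain ⟨x, hx, rfl⟩ : ∃ x ∈ (extChartAt 𝓘(ℂ, E) c).source, extChartAt 𝓘(ℂ, E) c x = z :=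
        ⟨_, (extChartAt 𝓘(ℂ, E) c).map_target hzt, (extChartAt 𝓘(ℂ, E) c).right_inv hzt⟩
      exact ⟨x, fun i => tangentCoordChange 𝓘(ℂ, E) c x x (e i), a,
        (h.isUnitaryFrame_tangentCoordChange_iff hx hz e).2 ⟨hz, he⟩, by simpa using ha,
        hFvalue c x hx e a⟩
  rw [heq]
  exact t.isCompact_biUnion fun c _ => hcompact c

theorem unitKRicciValues_nonempty [Nonempty M]
    (hR : ∀ x, IsKahlerCurvatureTensor (h.curvature x)) {k : ℕ} (hk : 1 ≤ k)
    (hkn : k ≤ Module.finrank ℂ E) : (h.unitKRicciValues k).Nonempty := by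
  obtain ⟨x⟩ := ‹Nonempty M›
  obtain ⟨e, he⟩ := h.exists_unitaryFrame x hkn
  -- The unit vector is the first member of the frame, which exists since k ≥ 1.
  exact ⟨_, (h.mem_unitKRicciValues_iff hR).2
    ⟨x, e, EuclideanSpace.single ⟨0, hk⟩ 1, he, by simp, rfl⟩⟩

/-- Here x is fixed, so the frames over a single point of one chart suffice, and M need not be
compact. -/
theorem isCompact_kScalar_values (x : M) (k : ℕ) :
    IsCompact {s : ℝ | ∃ e : Fin k → TangentSpace 𝓘(ℂ, E) x, IsUnitaryFrame (h.inner x) e ∧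
      s = (∑ i, ∑ j, h.curvature x (e i) (e i) (e j) (e j)).re} := by
  have hK : ({extChartAt 𝓘(ℂ, E) x x} : Set E) ⊆ (extChartAt 𝓘(ℂ, E) x).target :=
    Set.singleton_subset_iff.2 (mem_extChartAt_target x)
  set F : E × (Fin k → E) → ℝ := fun p => (∑ i, ∑ j, localCurvature (h.coordCLM x) p.1
    (p.2 i) (p.2 i) (p.2 j) (p.2 j)).re with hF
  have hcont : ContinuousOn F (h.unitaryFrames x {extChartAt 𝓘(ℂ, E) x x} k) := by
    refine Complex.continuous_re.comp_continuousOn (continuousOn_finsetSum _ fun i _ =>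
      continuousOn_finsetSum _ fun j _ => ?_)
    exact (h.isLocalMetric_coordCLM x).continuousOn_localCurvature (by fun_prop)
      (fun p hp => hK hp.1) (by fun_prop) (by fun_prop) (by fun_prop) (by fun_prop)
  convert (h.isCompact_unitaryFrames isCompact_singleton hK k).image_of_continuousOn hcont using 1
  have hmem : ∀ e : Fin k → E, IsUnitaryFrame (h.inner x) (V := TangentSpace 𝓘(ℂ, E) x) e ↔
      (extChartAt 𝓘(ℂ, E) x x, e) ∈ h.unitaryFrames x {extChartAt 𝓘(ℂ, E) x x} k := by
    intro e
    simp only [unitaryFrames, Set.mem_ofPred_eq, Set.mem_singleton_iff, true_and,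
      coord_extChartAt_self]
    rfl
  have hval : ∀ e : Fin k → E, F (extChartAt 𝓘(ℂ, E) x x, e) =
      (∑ i, ∑ j, h.curvature x (e i) (e i) (e j) (e j)).re := by
    intro e
    simp only [hF, ← h.curvature_eq_localCurvature_self]
  ext s
  constructor
  · rintro ⟨e, he, rfl⟩
    exact ⟨(_, e), (hmem e).1 he, hval e⟩
  · rintro ⟨⟨z, e⟩, hp, rfl⟩
    obtain rfl : z = extChartAt 𝓘(ℂ, E) x x := hp.1
    exact ⟨e, (hmem e).2 hp, hval e⟩

theorem exists_minimizesKScalar {x : M} (hR : IsKahlerCurvatureTensor (h.curvature x)) {k : ℕ}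
    (hkn : k ≤ Module.finrank ℂ E) :
    ∃ S : Submodule ℂ (TangentSpace 𝓘(ℂ, E) x), h.MinimizesKScalar k x S := by
  obtain ⟨e₀, he₀⟩ := h.exists_unitaryFrame x hkn
  obtain ⟨s, ⟨e, he, rfl⟩, hs⟩ := (h.isCompact_kScalar_values x k).exists_isLeast ⟨_, e₀, he₀, rfl⟩
  refine ⟨Submodule.span ℂ (Set.range e), he.finrank_span, fun T hT => ?_⟩
  obtain ⟨f, hf, hfT⟩ := h.exists_unitaryFrame_span_eq hT
  rw [h.kScalar_eq hR he rfl, h.kScalar_eq hR hf hfT]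
  exact hs ⟨f, hf, rfl⟩

theorem exists_maximizesKScalar {x : M} (hR : IsKahlerCurvatureTensor (h.curvature x)) {k : ℕ}
    (hkn : k ≤ Module.finrank ℂ E) :
    ∃ S : Submodule ℂ (TangentSpace 𝓘(ℂ, E) x), h.MaximizesKScalar k x S := by
  obtain ⟨e₀, he₀⟩ := h.exists_unitaryFrame x hkn
  obtain ⟨s, ⟨e, he, rfl⟩, hs⟩ :=
    (h.isCompact_kScalar_values x k).exists_isGreatest ⟨_, e₀, he₀, rfl⟩
  refine ⟨Submodule.span ℂ (Set.range e), he.finrank_span, fun T hT => ?_⟩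
  obtain ⟨f, hf, hfT⟩ := h.exists_unitaryFrame_span_eq hT
  rw [h.kScalar_eq hR he rfl, h.kScalar_eq hR hf hfT]
  exact hs ⟨f, hf, rfl⟩

/-! ### Curvature bounds from the extremal values -/

theorem kRicci_zero {x : M} (hR : IsKahlerCurvatureTensor (h.curvature x))
    (S : Submodule ℂ (TangentSpace 𝓘(ℂ, E) x)) : h.kRicci x S 0 = 0 := by
  have h1 := h.kRicci_smul hR S 0 0
  simpa using h1

theorem mul_normSq_le_kRicci {x : M} (hR : IsKahlerCurvatureTensor (h.curvature x)) {k : ℕ} {D : ℝ}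
    (hD : D ∈ lowerBounds (h.unitKRicciValues k)) {S : Submodule ℂ (TangentSpace 𝓘(ℂ, E) x)}
    (hS : Module.finrank ℂ S = k) {X : TangentSpace 𝓘(ℂ, E) x} (hX : X ∈ S) :
    D * h.normSq x X ≤ h.kRicci x S X := by
  by_cases hX0 : X = 0
  · rw [hX0, h.kRicci_zero hR]
    simp [normSq]
  obtain ⟨s, hs, hs1⟩ := h.exists_unit_smul hX0
  have h1 := hD ⟨x, S, (s : ℂ) • X, hS, S.smul_mem _ hX, by rw [h.normSq_smul, hs1], rfl⟩
  rw [h.kRicci_smul hR] at h1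
  have h2 : D * (s ^ 2 * h.normSq x X) ≤ s ^ 2 * h.kRicci x S X := by rwa [hs1, mul_one]
  have h3 : 0 < s ^ 2 := by positivity
  nlinarith

theorem kRicci_le_mul_normSq {x : M} (hR : IsKahlerCurvatureTensor (h.curvature x)) {k : ℕ} {D : ℝ}
    (hD : D ∈ upperBounds (h.unitKRicciValues k)) {S : Submodule ℂ (TangentSpace 𝓘(ℂ, E) x)}
    (hS : Module.finrank ℂ S = k) {X : TangentSpace 𝓘(ℂ, E) x} (hX : X ∈ S) :
    h.kRicci x S X ≤ D * h.normSq x X := by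
  by_cases hX0 : X = 0
  · rw [hX0, h.kRicci_zero hR]
    simp [normSq]
  obtain ⟨s, hs, hs1⟩ := h.exists_unit_smul hX0
  have h1 := hD ⟨x, S, (s : ℂ) • X, hS, S.smul_mem _ hX, by rw [h.normSq_smul, hs1], rfl⟩
  rw [h.kRicci_smul hR] at h1
  have h2 : s ^ 2 * h.kRicci x S X ≤ D * (s ^ 2 * h.normSq x X) := by rwa [hs1, mul_one]
  have h3 : 0 < s ^ 2 := by positivity
  nlinarith

theorem mul_normSq_le_planeCurvature {x : M} (hR : IsKahlerCurvatureTensor (h.curvature x))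
    {k : ℕ} {D : ℝ} (hD0 : 0 ≤ D) (hD : D ∈ lowerBounds (h.unitKRicciValues k))
    {S : Submodule ℂ (TangentSpace 𝓘(ℂ, E) x)} (hS : h.MinimizesKScalar k x S)
    (X : TangentSpace 𝓘(ℂ, E) x) :
    (k : ℝ) * D / ((k : ℝ) + 1) * h.normSq x X ≤ h.planeCurvature x S X := by
  obtain ⟨e, he, hspan⟩ := h.exists_unitaryFrame_span_eq hS.1
  rw [h.planeCurvature_eq hR he hspan]
  refine hR.mul_le_of_minimal (h.conj_symm x) (h.normSq_nonneg x) he (fun f hf => ?_) hD0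
    (fun Y hY => ?_) X
  · have h1 := hS.2 _ hf.finrank_span
    rwa [h.kScalar_eq hR he hspan, h.kScalar_eq hR hf rfl] at h1
  · rw [← h.kRicci_eq hR he hspan]
    exact h.mul_normSq_le_kRicci hR hD hS.1 (hspan ▸ hY)

/-- The tensor −R has the same symmetries, and a maximizer for R is a minimizer for −R; the
algebraic estimate is applied to −R and −D. -/
theorem planeCurvature_le_mul_normSq {x : M} (hR : IsKahlerCurvatureTensor (h.curvature x))
    {k : ℕ} {D : ℝ} (hD0 : D ≤ 0) (hD : D ∈ upperBounds (h.unitKRicciValues k))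
    {S : Submodule ℂ (TangentSpace 𝓘(ℂ, E) x)} (hS : h.MaximizesKScalar k x S)
    (X : TangentSpace 𝓘(ℂ, E) x) :
    h.planeCurvature x S X ≤ (k : ℝ) * D / ((k : ℝ) + 1) * h.normSq x X := by
  obtain ⟨e, he, hspan⟩ := h.exists_unitaryFrame_span_eq hS.1
  rw [h.planeCurvature_eq hR he hspan]
  have h0 := hR.neg.mul_le_of_minimal (h.conj_symm x) (h.normSq_nonneg x) he (D := -D)
    (fun f hf => ?_) (by linarith) (fun Y hY => ?_) X
  · simp only [Finset.sum_neg_distrib, Complex.neg_re, mul_neg, neg_div, neg_mul] at h0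
    exact neg_le_neg_iff.1 h0
  · have h1 := hS.2 _ hf.finrank_span
    rw [h.kScalar_eq hR he hspan, h.kScalar_eq hR hf rfl] at h1
    simpa only [Finset.sum_neg_distrib, Complex.neg_re, neg_le_neg_iff] using h1
  · have h1 := h.kRicci_le_mul_normSq hR hD hS.1 (hspan ▸ hY)
    rw [h.kRicci_eq hR he hspan] at h1
    simp only [Finset.sum_neg_distrib, Complex.neg_re, neg_mul, neg_le_neg_iff]
    exact h1

/-- The minimum is itself a value of Ric_k on a unit, hence nonzero, vector, so pointwise positivity
is uniform. -/
theorem exists_pos_isLeast_unitKRicciValues [CompactSpace M] [Nonempty M]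
    (hR : ∀ x, IsKahlerCurvatureTensor (h.curvature x)) {k : ℕ} (hk : 1 ≤ k)
    (hkn : k ≤ Module.finrank ℂ E) (hpos : h.KRicciPos k) :
    ∃ D, 0 < D ∧ IsLeast (h.unitKRicciValues k) D := by
  obtain ⟨D, hD⟩ := (h.isCompact_unitKRicciValues hR k).exists_isLeast
    (h.unitKRicciValues_nonempty hR hk hkn)
  refine ⟨D, ?_, hD⟩
  obtain ⟨x, S, X, hS, hX, hn, rfl⟩ := hD.1
  refine hpos x S hS X hX fun h0 => ?_
  simp [h0, normSq] at hn

theorem exists_neg_isGreatest_unitKRicciValues [CompactSpace M] [Nonempty M]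
    (hR : ∀ x, IsKahlerCurvatureTensor (h.curvature x)) {k : ℕ} (hk : 1 ≤ k)
    (hkn : k ≤ Module.finrank ℂ E) (hneg : h.KRicciNeg k) :
    ∃ D, D < 0 ∧ IsGreatest (h.unitKRicciValues k) D := by
  obtain ⟨D, hD⟩ := (h.isCompact_unitKRicciValues hR k).exists_isGreatest
    (h.unitKRicciValues_nonempty hR hk hkn)
  refine ⟨D, ?_, hD⟩
  obtain ⟨x, S, X, hS, hX, hn, rfl⟩ := hD.1
  refine hneg x S hS X hX fun h0 => ?_
  simp [h0, normSq] at hn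

end HermitianMetric

/-! ### The main theorem -/

theorem mainTheorem2 {E : Type*} [NormedAddCommGroup E] [NormedSpace ℂ E] [FiniteDimensional ℂ E]
    {M : Type*} [TopologicalSpace M] [T2Space M] [CompactSpace M] [ChartedSpace E M]
    [IsManifold 𝓘(ℂ, E) ω M] (h : HermitianMetric E M) (hCKL : h.IsChernKahlerLike)
    (k : ℕ) (hk : 1 ≤ k) (hkn : k ≤ Module.finrank ℂ E) :
    (h.KRicciPos k →
      h.UniformlyRCPos k ∧
      (∀ x : M, ∃ S : Submodule ℂ (TangentSpace 𝓘(ℂ, E) x), h.MinimizesKScalar k x S) ∧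
      (Nonempty M → ∃ D : ℝ, 0 < D ∧ IsLeast (h.unitKRicciValues k) D ∧
        ∀ (x : M) (S : Submodule ℂ (TangentSpace 𝓘(ℂ, E) x)), h.MinimizesKScalar k x S →
          ∀ X : TangentSpace 𝓘(ℂ, E) x,
            (k : ℝ) * D / ((k : ℝ) + 1) * h.normSq x X ≤ h.planeCurvature x S X)) ∧
    (h.KRicciNeg k →
      h.UniformlyRCNeg k ∧
      (∀ x : M, ∃ S : Submodule ℂ (TangentSpace 𝓘(ℂ, E) x), h.MaximizesKScalar k x S) ∧
      (Nonempty M → ∃ D : ℝ, D < 0 ∧ IsGreatest (h.unitKRicciValues k) D ∧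
        ∀ (x : M) (S : Submodule ℂ (TangentSpace 𝓘(ℂ, E) x)), h.MaximizesKScalar k x S →
          ∀ X : TangentSpace 𝓘(ℂ, E) x,
            h.planeCurvature x S X ≤ (k : ℝ) * D / ((k : ℝ) + 1) * h.normSq x X)) := by
  have hR : ∀ x, IsKahlerCurvatureTensor (h.curvature x) := h.isKahlerCurvatureTensor hCKL
  have hk0 : (0 : ℝ) < k := by exact_mod_cast hk
  refine ⟨fun hpos => ⟨fun x => ?_, fun x => h.exists_minimizesKScalar (hR x) hkn, fun hM => ?_⟩,
    fun hneg => ⟨fun x => ?_, fun x => h.exists_maximizesKScalar (hR x) hkn, fun hM => ?_⟩⟩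
  -- The claim is pointwise, so the given x provides the nonemptiness needed for D to exist.
  · have : Nonempty M := ⟨x⟩
    obtain ⟨D, hD0, hD⟩ := h.exists_pos_isLeast_unitKRicciValues hR hk hkn hpos
    obtain ⟨S, hS⟩ := h.exists_minimizesKScalar (hR x) hkn
    refine ⟨S, hS.1, fun u hu => ?_⟩
    have hu' : 0 < h.normSq x u := h.pos x u hu
    exact lt_of_lt_of_le (by positivity) (h.mul_normSq_le_planeCurvature (hR x) hD0.le hD.2 hS u)
  · obtain ⟨D, hD0, hD⟩ := h.exists_pos_isLeast_unitKRicciValues hR hk hkn hpos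
    exact ⟨D, hD0, hD, fun x S hS X => h.mul_normSq_le_planeCurvature (hR x) hD0.le hD.2 hS X⟩
  · have : Nonempty M := ⟨x⟩
    obtain ⟨D, hD0, hD⟩ := h.exists_neg_isGreatest_unitKRicciValues hR hk hkn hneg
    obtain ⟨S, hS⟩ := h.exists_maximizesKScalar (hR x) hkn
    refine ⟨S, hS.1, fun u hu => ?_⟩
    have hu' : 0 < h.normSq x u := h.pos x u hu
    refine lt_of_le_of_lt (h.planeCurvature_le_mul_normSq (hR x) hD0.le hD.2 hS u) ?_
    exact mul_neg_of_neg_of_pos (div_neg_of_neg_of_pos (mul_neg_of_pos_of_neg hk0 hD0)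
      (by positivity)) hu'
  · obtain ⟨D, hD0, hD⟩ := h.exists_neg_isGreatest_unitKRicciValues hR hk hkn hneg
    exact ⟨D, hD0, hD, fun x S hS X => h.planeCurvature_le_mul_normSq (hR x) hD0.le hD.2 hS X⟩
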